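/- **Setting.** Let $K$ be a field that is complete with respect to a non-trivial non-Archimedean absolute value. Fix an ultrafilter $U$ on a set $I$ that is countably incomplete (so that the ultrapower extension $*$ by $U$ is countably saturated); ${}^*K$ and ${}^*\mathbb R$ denote the ultrapowers, $\approx$ means "infinitely close", and $\mathrm{st}_K$ is the standard part map, defined on the set $\mathrm{ns}({}^*K)$ of those $y\in{}^*K$ that are infinitely close to some (unique) element of $K$. For a ring $\mathcal R$ of subsets of a set $X$ and an additive $\mu:\mathcal R\to K$ put $\|A\|_\mu=\sup\{|\mu(B)|: B\in\mathcal R,\ B\subseteq A\}$, $N_\mu(x)=\inf\{\|A\|_\mu: x\in A\in\mathcal R\}$ and $\|f\|_\mu=\sup_{x\in X}|f(x)|N_\mu(x)$ for $f:X\to K$. A simple function is a finite sum $g=\sum_j y_j\chi_{A_j}$ with $y_j\in K$, $A_j\in\mathcal R$, and $\int g\,d\mu=\sum_j y_j\mu(A_j)$. A function $f:X\to K$ is $\mu$-integrable if there are simple $f_n$ with $\|f-f_n\|_\mu\to0$, and then $\int f\,d\mu=\lim_n\int f_n\,d\mu$. Let $(\Omega,\mathcal S,\nu)$ be an internal measure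 space: $\Omega$ is a nonempty internal set, $\mathcal S$ is an internal ring of internal subsets of $\Omega$ which is covering and separating (for $a\ne b$ in $\Omega$ there is $A\in\mathcal S$ with $a\in A$, $b\notin A$, and every point lies in some $A\in\mathcal S$), and $\nu:\mathcal S\to{}^*K$ is internal and additive such that $\|A\|_\nu$ is a hyperreal number for every $A\in\mathcal S$. The notions $\|A\|_\nu$, $N_\nu$, $\|F\|_\nu$ for internal $F:\Omega\to{}^*K$, and, for $*$-simple functions $F=\sum_{j=1}^N y_j\chi_{A_j}$ ($N\in{}^*\mathbb N$, internal sequences $y_j\in{}^*K$, $A_j\in\mathcal S$), the integral $\int F\,d\nu=\sum_{j=1}^N y_j\nu(A_j)\in{}^*K$, are defined by transfer. Assume that $$\|A\|_\nu=\sup_{x\in A}N_\nu(x)\quad\text{(supremum in } {}^*\mathbb R_{\ge0})\quad\text{for all }A\in\mathcal S,$$ and that $\nu$ has values in $\mathrm{ns}({}^*K)$. A (possibly external) set $A\subseteq\Omega$ is a Loeb null set if $N_\nu(x)\approx0$ for all $x\in A$. Let $\mathcal S_L$ be the ring of all $A\subseteq\Omega$ for which there is $B\in\mathcal S$ such that $A\,\Delta\,B$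 is a Loeb null set, and let $\nu_L(A)=\mathrm{st}_K(\nu(B))\in K$ for such a $B$. *Loeb integrable* means integrable with respect to $(\Omega,\mathcal S_L,\nu_L)$ in the above sense. A $*$-simple $F:\Omega\to{}^*K$ is $S$-integrable if (i) $\|F\|_\nu$ is finite; (ii) $\|F\chi_A\|_\nu\approx0$ for all $A\in\mathcal S$ with $\|A\|_\nu\approx0$; (iii) $\|F\chi_A\|_\nu\approx0$ for all $A\in\mathcal S$ such that $F(x)\approx0$ for all $x\in A$. An internal $F:\Omega\to{}^*K$ is a lifting of $f:\Omega\to K$ if $F(x)\approx f(x)$, i.e. $\mathrm{st}_K(F(x))=f(x)$, for all $x$ outside a Loeb null set. **Theorem.** (a) Every Loeb integrable $f:\Omega\to K$ has an $S$-integrable $*$-simple lifting $F:\Omega\to{}^*K$. (b) Let $K$ be locally compact and let $F:\Omega\to{}^*K$ be an $S$-integrable $*$-simple function such that $f=\mathrm{st}_K\circ F$ is defined outside a Loeb null set. Then $f$ (with arbitrary values in $K$ on a Loeb null set) is Loeb integrable. (c) Whenever $f:\Omega\to K$ is Loeb integrable and $F$ is an $S$-integrable $*$-simple lifting of $f$ (in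 particular under the hypotheses of (a) or (b)), $\int_\Omega F\,d\nu$ is nearstandard and $$\int_\Omega f\,d\nu_L=\mathrm{st}_K\int_\Omega F\,d\nu ,$$ where $\int_\Omega f\,d\nu_L$ exists as the common limit of $\int_\Omega f_n\,d\nu_L$ over all sequences of $\mathcal S_L$-simple functions $f_n$ with $\|f-f_n\|_{\nu_L}\to0$. -/

import Mathlib

open Filter Topology
open scoped ENNReal NNReal

noncomputable section

namespace NALoeb

/-! ### Set rings, `K`-valued finitely additive measures and their integrals -/

section Standard

variable {X K : Type*} [NontriviallyNormedField K]

/-- `‖A‖_μ = sup {|μ B| : B ⊆ A, B ∈ R}`, as an element of `[0, ∞]`. -/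
def setNorm (R : Set (Set X)) (μ : Set X → K) (A : Set X) : ℝ≥0∞ :=
  ⨆ B ∈ {B : Set X | B ∈ R ∧ B ⊆ A}, ‖μ B‖ₑ

/-- The norm function `N_μ(x) = inf {‖A‖_μ : x ∈ A ∈ R}`. -/
def weight (R : Set (Set X)) (μ : Set X → K) (x : X) : ℝ≥0∞ :=
  ⨅ A ∈ {A : Set X | A ∈ R ∧ x ∈ A}, setNorm R μ A

/-- The seminorm `‖f‖_μ = sup_x |f x| N_μ(x)` of a function, an element of `[0, ∞]`. -/
def funNorm (R : Set (Set X)) (μ : Set X → K) (f : X → K) : ℝ≥0∞ :=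
  ⨆ x, ‖f x‖ₑ * weight R μ x

/-- `f = ∑ j, y j · χ_{A j}` with finitely many sets `A j ∈ R`. -/
def IsSimpleRep (R : Set (Set X)) (f : X → K) {n : ℕ} (A : Fin n → Set X) (y : Fin n → K) :
    Prop :=
  (∀ j, A j ∈ R) ∧ ∀ x, f x = ∑ j, (A j).indicator (fun _ => y j) x

/-- Simple functions (step functions). -/
def IsSimple (R : Set (Set X)) (f : X → K) : Prop :=
  ∃ (n : ℕ) (A : Fin n → Set X) (y : Fin n → K), IsSimpleRep R f A y

open Classical in
/-- The integral `∑ j, y j · μ (A j)` of a simple function `∑ j, y j · χ_{A j}`. For an additive `μ`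
on a ring of sets it does not depend on the representation. -/
def simpleIntegral (R : Set (Set X)) (μ : Set X → K) (f : X → K) : K :=
  if h : ∃ c : K, ∃ (n : ℕ) (A : Fin n → Set X) (y : Fin n → K),
      IsSimpleRep R f A y ∧ c = ∑ j, y j * μ (A j)
  then h.choose else 0

/-- `(f n)` is a sequence of simple functions with `‖f - f n‖_μ → 0`. -/
def IsApprox (R : Set (Set X)) (μ : Set X → K) (f : X → K) (g : ℕ → X → K) : Prop :=
  (∀ n, IsSimple R (g n)) ∧
    Tendsto (fun n => funNorm R μ (fun x => f x - g n x)) atTop (𝓝 0)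

/-- `f` is `μ`-integrable: a limit of simple functions with respect to `‖ ‖_μ`. -/
def IsIntegrable (R : Set (Set X)) (μ : Set X → K) (f : X → K) : Prop :=
  ∃ g : ℕ → X → K, IsApprox R μ f g

/-- `f` is `μ`-integrable and `∫ f dμ = a`: the integrals of simple functions converge to `a` for
every sequence of simple functions that converges to `f`. -/
def HasIntegral (R : Set (Set X)) (μ : Set X → K) (f : X → K) (a : K) : Prop :=
  IsIntegrable R μ f ∧
    ∀ g : ℕ → X → K, IsApprox R μ f g →
      Tendsto (fun n => simpleIntegral R μ (g n)) atTop (𝓝 a)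

variable (X K) in
/-- A covering and separating ring of subsets of `X` with a finitely additive, bounded `K`-valued
measure. The values of `μ` outside `sets` play no role. -/
structure FinAddMeasureSpace where
  sets : Set (Set X)
  isSetRing : MeasureTheory.IsSetRing sets
  covering : ∀ x, ∃ A ∈ sets, x ∈ A
  separating : ∀ x y, x ≠ y → ∃ A ∈ sets, x ∈ A ∧ y ∉ A
  μ : Set X → K
  additive : ∀ A ∈ sets, ∀ B ∈ sets, Disjoint A B → μ (A ∪ B) = μ A + μ B
  bounded : ∀ A ∈ sets, setNorm sets μ A < ∞

end Standard

/-! ### Ultraproducts and internal objects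

The nonstandard extension is the ultrapower by `U`: `Germ U Y` is `*Y`. The internal set `Ω`
given by sets `X i` is their ultraproduct `Star U X`. The internal subsets of `Ω` and the internal
functions `Ω → *K` are the elements of the ultraproducts of the `Set (X i)` and of the `X i → K`. -/

section Nonstandard

variable {I : Type*} (U : Ultrafilter I)

/-- The ultraproduct of a family of sets. -/
abbrev Star (X : I → Type*) := (U : Filter I).Product X

variable {U}
variable {X Y : I → Type*} {Z K : Type*}

/-- The internal function `Star U X → *Z` with components `f i`. -/
def starMap (f : ∀ i, X i → Z) : Star U X → Germ (U : Filter I) Z :=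
  Quotient.lift (s := productSetoid (U : Filter I) X)
    (fun x => ((fun i => f i (x i) : I → Z) : Germ (U : Filter I) Z))
    (fun _ _ h => Germ.coe_eq.2 (h.mono fun i hi => congrArg (f i) hi))

/-- The internal function of two variables with components `f i`. -/
def starMap₂ (f : ∀ i, X i → Y i → Z) : Star U X → Star U Y → Germ (U : Filter I) Z :=
  Quotient.lift₂ (s₁ := productSetoid (U : Filter I) X) (s₂ := productSetoid (U : Filter I) Y)
    (fun x y => ((fun i => f i (x i) (y i) : I → Z) : Germ (U : Filter I) Z))
    (fun _ _ _ _ h h' => Germ.coe_eq.2 ((h.and h').mono fun i hi =>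
      (congrArg (fun t => f i t _) hi.1).trans (congrArg (f i _) hi.2)))

/-- The elements of an internal set: `[x i] ∈ [A i]` if and only if `x i ∈ A i` for `U`-almost all
`i`. -/
def elems (A : Star U (fun i => Set (X i))) : Set (Star U X) :=
  {x | (starMap₂ (fun i (y : X i) (B : Set (X i)) => y ∈ B) x A).LiftPred id}

/-- The internal set with components `A i`. -/
def mkSet (A : ∀ i, Set (X i)) : Set (Star U X) :=
  elems (A : Star U (fun i => Set (X i)))

/-- The value `F x` of an internal function `F : Ω → *Z` at `x ∈ Ω`. -/
def app (F : Star U (fun i => X i → Z)) (x : Star U X) : Germ (U : Filter I) Z :=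
  starMap₂ (fun _ G y => G y) F x

/-- `st y = a`: the point `y` of `*Y` lies in the monad of `a`. -/
def IsSt {Y : Type*} [TopologicalSpace Y] (y : Germ (U : Filter I) Y) (a : Y) : Prop :=
  y.Tendsto (𝓝 a)

/-- Nearstandard points. -/
def IsNearstandard {Y : Type*} [TopologicalSpace Y] (y : Germ (U : Filter I) Y) : Prop :=
  ∃ a, IsSt y a

open Classical in
/-- The standard part of a nearstandard point of `*K`, with the value `0` elsewhere. -/
def st [Zero K] [TopologicalSpace K] (y : Germ (U : Filter I) K) : K :=
  if h : IsNearstandard y then h.choose else 0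

/-- `y ≈ 0` for `y` in `*K` or in `*[0, ∞]`. -/
def IsInfinitesimal {Y : Type*} [Zero Y] [TopologicalSpace Y] (y : Germ (U : Filter I) Y) :
    Prop :=
  IsSt y 0

/-- `y ∈ *[0, ∞]` is bounded by a standard real number. -/
def IsFinite (y : Germ (U : Filter I) ℝ≥0∞) : Prop :=
  ∃ C : ℝ≥0, y ≤ ((C : ℝ≥0∞) : Germ (U : Filter I) ℝ≥0∞)

/-! ### Internal measure spaces -/

variable [NontriviallyNormedField K] (M : ∀ i, FinAddMeasureSpace (X i) K)

/-- The internal ring `𝒮` of the internal measure space `(Ω, 𝒮, ν)` with components `M i`. -/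
def measSets : Set (Star U (fun i => Set (X i))) :=
  mkSet (fun i => (M i).sets)

/-- The internal measure `ν`. -/
def intMeasure (A : Star U (fun i => Set (X i))) : Germ (U : Filter I) K :=
  starMap (fun i => (M i).μ) A

/-- `‖A‖_ν`. -/
def intSetNorm (A : Star U (fun i => Set (X i))) : Germ (U : Filter I) ℝ≥0∞ :=
  starMap (fun i => setNorm (M i).sets (M i).μ) A

/-- `N_ν(x)`. -/
def intWeight (x : Star U X) : Germ (U : Filter I) ℝ≥0∞ :=
  starMap (fun i => weight (M i).sets (M i).μ) x

/-- `‖F‖_ν` for an internal function `F`. -/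
def intFunNorm (F : Star U (fun i => X i → K)) : Germ (U : Filter I) ℝ≥0∞ :=
  starMap (fun i => funNorm (M i).sets (M i).μ) F

/-- `‖F · χ_A‖_ν` for an internal function `F` and an internal set `A`. -/
def intFunNormOn (F : Star U (fun i => X i → K)) (A : Star U (fun i => Set (X i))) :
    Germ (U : Filter I) ℝ≥0∞ :=
  starMap₂ (fun i (G : X i → K) (B : Set (X i)) =>
    funNorm (M i).sets (M i).μ (B.indicator G)) F A

/-- `*`-simple functions `F = ∑_{j=1}^N y_j χ_{A_j}`, `N ∈ *ℕ`, with internal sequences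
`y_j ∈ *K` and `A_j ∈ 𝒮`: the components are simple for almost all indices. -/
def IsStarSimple (F : Star U (fun i => X i → K)) : Prop :=
  F ∈ mkSet (U := U) (fun i => {G : X i → K | IsSimple (M i).sets G})

/-- `∫ F dν = ∑_{j=1}^N y_j ν(A_j)` for a `*`-simple function `F`. -/
def intIntegral (F : Star U (fun i => X i → K)) : Germ (U : Filter I) K :=
  starMap (fun i => simpleIntegral (M i).sets (M i).μ) F

/-- `S`-integrable `*`-simple functions. -/
structure IsSIntegrable (F : Star U (fun i => X i → K)) : Prop where
  starSimple : IsStarSimple M F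
  finite : IsFinite (intFunNorm M F)
  absCont : ∀ A ∈ measSets (U := U) M, IsInfinitesimal (intSetNorm M A) →
    IsInfinitesimal (intFunNormOn M F A)
  small : ∀ A ∈ measSets (U := U) M, (∀ x ∈ elems A, IsInfinitesimal (app F x)) →
    IsInfinitesimal (intFunNormOn M F A)

/-! ### The Loeb space -/

/-- Loeb null sets (possibly external). -/
def IsLoebNull (A : Set (Star U X)) : Prop :=
  ∀ x ∈ A, IsInfinitesimal (intWeight M x)

/-- The ring `𝒮_L` of Loeb measurable sets. -/
def loebSets : Set (Set (Star U X)) :=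
  {A | ∃ B ∈ measSets (U := U) M, IsLoebNull M (symmDiff A (elems B))}

open Classical in
/-- The Loeb measure: `ν_L(A) = st (ν B)` where `B ∈ 𝒮` and `A Δ B` is a Loeb null set. -/
def loebMeasure (A : Set (Star U X)) : K :=
  if h : ∃ B ∈ measSets (U := U) M, IsLoebNull M (symmDiff A (elems B))
  then st (intMeasure M h.choose) else 0

/-- `F` is a lifting of `f`: `st (F x)` exists and equals `f x` outside a Loeb null set. -/
def IsLifting (F : Star U (fun i => X i → K)) (f : Star U X → K) : Prop :=
  IsLoebNull M {x | ¬ IsSt (app F x) (f x)}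

end Nonstandard

end NALoeb

end

/-! The engine is one ultrametric estimate: when ‖A‖_μ = sup_{x ∈ A} N_μ(x), every simple g
satisfies |∫ g dμ| ≤ ‖g‖_μ (`IsRegular.enorm_sum_le`), so the integral of simple functions is well
defined and contracting. In terms of components, "infinitely close" is convergence along `U`.

Since ν has nearstandard values, ‖A‖_{ν_L} and N_{ν_L}(x) are the finite standard parts of ‖B‖_ν,
for B representing A, and of N_ν(x) (`Represents.tendsto_setNorm`, `tendsto_weight`). Hence the Loeb
null points are those of Loeb weight 0, the Loeb space satisfies the same supremum formula
(`isRegular_loeb`), and ‖G‖_ν can be compared with ‖st G‖_{ν_L} provided |G| N_ν is infinitesimal at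
the null points.

(a) Simple functions lift, and the lifts G_n of an approximating sequence are Cauchy for ‖ ‖_ν.
Saturation gives one *-simple F close to all G_n, which inherits S-integrability from them. (b) By
saturation, conditions (iii) and (ii) become standard cutoffs: the parts of F with very small or
very large values have norm at most ε. The remaining values lie in a bounded, hence totally bounded,
subset of K and can be rounded to finitely many values; the rounded function has a Loeb simple
standard part. (c) By the estimate, ∫ F dν is within any c > ‖f - g‖ of ∫ g dν_L for each Loeb
simple g. So its components are Cauchy along `U`, and completeness of K yields the standard part. -/

namespace NALoeb

/-! ### Simple functions and the basic estimate for their integrals -/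

section RegularMeasure

variable {X K : Type*} [NontriviallyNormedField K]

/-- The properties of a finitely additive measure on which its integral rests: additivity on a ring
of sets, and `‖A‖_μ = sup_{x ∈ A} N_μ(x)`. -/
structure IsRegular (R : Set (Set X)) (μ : Set X → K) : Prop where
  isSetRing : MeasureTheory.IsSetRing R
  additive : ∀ A ∈ R, ∀ B ∈ R, Disjoint A B → μ (A ∪ B) = μ A + μ B
  setNorm_le : ∀ A ∈ R, setNorm R μ A ≤ ⨆ x ∈ A, weight R μ x

theorem enorm_le_setNorm {R : Set (Set X)} {μ : Set X → K} {A B : Set X} (hB : B ∈ R)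
    (hBA : B ⊆ A) : ‖μ B‖ₑ ≤ setNorm R μ A :=
  le_iSup₂_of_le B ⟨hB, hBA⟩ le_rfl

theorem lt_setNorm {R : Set (Set X)} {μ : Set X → K} {A : Set X} {c : ℝ≥0∞}
    (h : c < setNorm R μ A) : ∃ B ∈ R, B ⊆ A ∧ c < ‖μ B‖ₑ := by
  obtain ⟨B, hB⟩ := lt_iSup_iff.1 h
  obtain ⟨hB, hc⟩ := lt_iSup_iff.1 hB
  exact ⟨B, hB.1, hB.2, hc⟩

theorem weight_le_setNorm {R : Set (Set X)} {μ : Set X → K} {A : Set X} {x : X} (hA : A ∈ R)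
    (hx : x ∈ A) : weight R μ x ≤ setNorm R μ A :=
  iInf₂_le_of_le A ⟨hA, hx⟩ le_rfl

theorem weight_lt {R : Set (Set X)} {μ : Set X → K} {x : X} {c : ℝ≥0∞}
    (h : weight R μ x < c) : ∃ A ∈ R, x ∈ A ∧ setNorm R μ A < c := by
  obtain ⟨A, hA⟩ := iInf_lt_iff.1 h
  obtain ⟨hA, hc⟩ := iInf_lt_iff.1 hA
  exact ⟨A, hA.1, hA.2, hc⟩

theorem mul_weight_le_funNorm (R : Set (Set X)) (μ : Set X → K) (f : X → K) (x : X) :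
    ‖f x‖ₑ * weight R μ x ≤ funNorm R μ f :=
  le_iSup (fun x => ‖f x‖ₑ * weight R μ x) x

theorem funNorm_le {R : Set (Set X)} {μ : Set X → K} {f : X → K} {c : ℝ≥0∞}
    (h : ∀ x, ‖f x‖ₑ * weight R μ x ≤ c) : funNorm R μ f ≤ c :=
  iSup_le h

theorem funNorm_mono {R : Set (Set X)} {μ : Set X → K} {f g : X → K}
    (h : ∀ x, ‖f x‖ₑ ≤ ‖g x‖ₑ) : funNorm R μ f ≤ funNorm R μ g :=
  iSup_mono fun x => mul_le_mul_left (h x) _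

theorem funNorm_sub_comm (R : Set (Set X)) (μ : Set X → K) (f g : X → K) :
    funNorm R μ (fun x => f x - g x) = funNorm R μ (fun x => g x - f x) := by
  simp only [funNorm, enorm_sub_rev]

theorem enorm_add_le_max [IsUltrametricDist K] (a b : K) : ‖a + b‖ₑ ≤ max ‖a‖ₑ ‖b‖ₑ := by
  have h := IsUltrametricDist.nnnorm_add_le_max a b
  simp only [enorm_eq_nnnorm]
  exact_mod_cast h

theorem funNorm_le_max [IsUltrametricDist K] (R : Set (Set X)) (μ : Set X → K) {f g h : X → K}
    (hf : ∀ x, f x = g x + h x) : funNorm R μ f ≤ max (funNorm R μ g) (funNorm R μ h) := by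
  refine funNorm_le fun x => ?_
  rw [hf x]
  calc _ ≤ max ‖g x‖ₑ ‖h x‖ₑ * weight R μ x := by gcongr; exact enorm_add_le_max _ _
    _ = max (‖g x‖ₑ * weight R μ x) (‖h x‖ₑ * weight R μ x) := by
        rcases le_total ‖g x‖ₑ ‖h x‖ₑ with h' | h'
        · rw [max_eq_right h', max_eq_right]; gcongr
        · rw [max_eq_left h', max_eq_left]; gcongr
    _ ≤ _ := max_le_max (mul_weight_le_funNorm R μ g x) (mul_weight_le_funNorm R μ h x)

variable {R : Set (Set X)} {μ : Set X → K}

theorem iUnion_mem_of_isSetRing (hR : MeasureTheory.IsSetRing R) {ι : Type*} [Finite ι]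
    {A : ι → Set X} (hA : ∀ j, A j ∈ R) : (⋃ j, A j) ∈ R := by
  have := Fintype.ofFinite ι
  have h := hR.biUnion_mem Finset.univ fun j _ => hA j
  simpa using h

theorem IsRegular.measure_split (h : IsRegular R μ) {A B : Set X} (hA : A ∈ R) (hB : B ∈ R) :
    μ A = μ (A ∩ B) + μ (A \ B) := by
  rw [← h.additive _ (h.isSetRing.inter_mem hA hB) _ (h.isSetRing.sdiff_mem hA hB)
    (Set.disjoint_left.2 fun x hx hx' => hx'.2 hx.2), Set.inter_union_sdiff]

/-- Induction on the number of sets, splitting B into B ∩ A_0 and B \ A_0. The extra constant c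
absorbs y_0 on the first piece, so no disjoint representation is ever needed; the ultrametric
inequality joins the two pieces by a maximum. -/
theorem IsRegular.enorm_sum_inter_le [IsUltrametricDist K] (h : IsRegular R μ) (n : ℕ) :
    ∀ (A : Fin n → Set X) (y : Fin n → K), (∀ j, A j ∈ R) → ∀ B ∈ R, ∀ c : K,
      ‖c * μ B + ∑ j, y j * μ (B ∩ A j)‖ₑ ≤
        ⨆ x ∈ B, ‖c + ∑ j, (A j).indicator (fun _ => y j) x‖ₑ * weight R μ x := by
  induction n with
  | zero =>
    intro A y hA B hB c
    simp only [Finset.univ_eq_empty, Finset.sum_empty, add_zero, enorm_mul, ← ENNReal.mul_iSup]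
    gcongr
    exact (enorm_le_setNorm hB subset_rfl).trans (h.setNorm_le B hB)
  | succ n ih =>
    intro A y hA B hB c
    have hI := h.isSetRing.inter_mem hB (hA 0)
    have hD := h.isSetRing.sdiff_mem hB (hA 0)
    have h1 := ih (fun j => A j.succ) (fun j => y j.succ) (fun j => hA _) _ hI (c + y 0)
    have h2 := ih (fun j => A j.succ) (fun j => y j.succ) (fun j => hA _) _ hD c
    have key : c * μ B + ∑ j, y j * μ (B ∩ A j) =
        ((c + y 0) * μ (B ∩ A 0) + ∑ j : Fin n, y j.succ * μ (B ∩ A 0 ∩ A j.succ)) +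
        (c * μ (B \ A 0) + ∑ j : Fin n, y j.succ * μ ((B \ A 0) ∩ A j.succ)) := by
      have : ∀ j : Fin n, μ (B ∩ A j.succ) =
          μ (B ∩ A 0 ∩ A j.succ) + μ ((B \ A 0) ∩ A j.succ) := fun j => by
        rw [h.measure_split (h.isSetRing.inter_mem hB (hA j.succ)) (hA 0)]
        congr 2
        · exact Set.inter_right_comm _ _ _
        · ext x; simp; tauto
      simp only [Fin.sum_univ_succ, this, mul_add, Finset.sum_add_distrib]
      rw [h.measure_split hB (hA 0)]
      ring
    rw [key]
    refine (enorm_add_le_max _ _).trans (max_le (h1.trans ?_) (h2.trans ?_))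
    · refine iSup₂_le fun x hx => le_iSup₂_of_le x hx.1 (le_of_eq ?_)
      rw [Fin.sum_univ_succ, Set.indicator_of_mem hx.2, add_assoc]
    · refine iSup₂_le fun x hx => le_iSup₂_of_le x hx.1 (le_of_eq ?_)
      rw [Fin.sum_univ_succ, Set.indicator_of_notMem hx.2, zero_add]

theorem IsRegular.enorm_sum_le [IsUltrametricDist K] (h : IsRegular R μ) {f : X → K} {n : ℕ}
    {A : Fin n → Set X} {y : Fin n → K} (hf : IsSimpleRep R f A y) :
    ‖∑ j, y j * μ (A j)‖ₑ ≤ funNorm R μ f := by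
  have h1 := h.enorm_sum_inter_le n A y hf.1 _ (iUnion_mem_of_isSetRing h.isSetRing hf.1) 0
  have h2 : ∀ j, (⋃ k, A k) ∩ A j = A j := fun j =>
    Set.inter_eq_right.2 (Set.subset_iUnion A j)
  simp only [zero_mul, zero_add, h2] at h1
  refine h1.trans (iSup₂_le fun x _ => ?_)
  rw [← hf.2 x]
  exact mul_weight_le_funNorm R μ f x

theorem IsSimpleRep.sub {f g : X → K} {n m : ℕ} {A : Fin n → Set X} {y : Fin n → K}
    {B : Fin m → Set X} {z : Fin m → K} (hf : IsSimpleRep R f A y) (hg : IsSimpleRep R g B z) :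
    IsSimpleRep R (fun x => f x - g x) (Fin.append A B) (Fin.append y (fun j => -z j)) := by
  refine ⟨fun j => ?_, fun x => ?_⟩
  · refine Fin.addCases (fun j => ?_) (fun j => ?_) j
    · simpa using hf.1 j
    · simpa using hg.1 j
  · dsimp only
    rw [Fin.sum_univ_add, hf.2 x, hg.2 x]
    simp only [Fin.append_left, Fin.append_right, sub_eq_add_neg, ← Finset.sum_neg_distrib]
    congr 1
    refine Finset.sum_congr rfl fun j _ => ?_
    by_cases hx : x ∈ B j <;> simp [hx]

theorem IsRegular.enorm_sum_sub_sum_le [IsUltrametricDist K] (h : IsRegular R μ) {f g : X → K}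
    {n m : ℕ} {A : Fin n → Set X} {y : Fin n → K} {B : Fin m → Set X} {z : Fin m → K}
    (hf : IsSimpleRep R f A y) (hg : IsSimpleRep R g B z) :
    ‖∑ j, y j * μ (A j) - ∑ j, z j * μ (B j)‖ₑ ≤ funNorm R μ (fun x => f x - g x) := by
  have := h.enorm_sum_le (hf.sub hg)
  simpa [Fin.sum_univ_add, sub_eq_add_neg] using this

/-- The difference of two representations of f represents 0, so the basic estimate makes the two
sums agree. -/
theorem IsRegular.simpleIntegral_eq [IsUltrametricDist K] (h : IsRegular R μ) {f : X → K} {n : ℕ}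
    {A : Fin n → Set X} {y : Fin n → K} (hf : IsSimpleRep R f A y) :
    simpleIntegral R μ f = ∑ j, y j * μ (A j) := by
  have hex : ∃ c : K, ∃ (n : ℕ) (A : Fin n → Set X) (y : Fin n → K),
      IsSimpleRep R f A y ∧ c = ∑ j, y j * μ (A j) := ⟨_, n, A, y, hf, rfl⟩
  rw [simpleIntegral, dif_pos hex]
  obtain ⟨m, B, z, hg, hc⟩ := hex.choose_spec
  rw [hc, ← sub_eq_zero, ← enorm_eq_zero, ← le_zero_iff]
  refine (h.enorm_sum_sub_sum_le hg hf).trans (funNorm_le fun x => ?_)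
  simp

theorem IsRegular.enorm_simpleIntegral_sub_le [IsUltrametricDist K] (h : IsRegular R μ)
    {f g : X → K} (hf : IsSimple R f) (hg : IsSimple R g) :
    ‖simpleIntegral R μ f - simpleIntegral R μ g‖ₑ ≤ funNorm R μ (fun x => f x - g x) := by
  obtain ⟨n, A, y, hf⟩ := hf
  obtain ⟨m, B, z, hg⟩ := hg
  rw [h.simpleIntegral_eq hf, h.simpleIntegral_eq hg]
  exact h.enorm_sum_sub_sum_le hf hg

theorem sep_add_sum_mem (hR : MeasureTheory.IsSetRing R) (T : Set K) (n : ℕ) :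
    ∀ (A : Fin n → Set X) (y : Fin n → K), (∀ j, A j ∈ R) → ∀ B ∈ R, ∀ c : K,
      {x ∈ B | c + ∑ j, (A j).indicator (fun _ => y j) x ∈ T} ∈ R := by
  induction n with
  | zero =>
    intro A y hA B hB c
    by_cases hc : c ∈ T
    · simpa [hc] using hB
    · simpa [hc] using hR.empty_mem
  | succ n ih =>
    intro A y hA B hB c
    have h1 := ih (fun j => A j.succ) (fun j => y j.succ) (fun j => hA _) _
      (hR.inter_mem hB (hA 0)) (c + y 0)
    have h2 := ih (fun j => A j.succ) (fun j => y j.succ) (fun j => hA _) _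
      (hR.sdiff_mem hB (hA 0)) c
    convert hR.union_mem h1 h2 using 1
    ext x
    by_cases hx : x ∈ A 0 <;> simp [Fin.sum_univ_succ, hx, add_assoc]

/-- A ring need not contain X; excluding 0 from T confines the preimage to the union of the sets in
a representation. -/
theorem IsSimple.preimage_mem (hR : MeasureTheory.IsSetRing R) {f : X → K} (hf : IsSimple R f)
    {T : Set K} (hT : (0 : K) ∉ T) : f ⁻¹' T ∈ R := by
  obtain ⟨n, A, y, hA, hf⟩ := hf
  convert sep_add_sum_mem hR T n A y hA _ (iUnion_mem_of_isSetRing hR hA) 0 using 1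
  ext x
  simp only [Set.mem_preimage, zero_add, Set.mem_ofPred_eq, ← hf x]
  refine ⟨fun hx => ⟨?_, hx⟩, And.right⟩
  by_contra hx'
  refine hT ?_
  have : f x = 0 := by
    rw [hf x]
    exact Finset.sum_eq_zero fun j _ => Set.indicator_of_notMem
      (fun hj => hx' (Set.mem_iUnion.2 ⟨j, hj⟩)) _
  rwa [← this]

theorem isIntegrable_of_forall {f : X → K}
    (h : ∀ ε : ℝ≥0∞, 0 < ε → ∃ g, IsSimple R g ∧ funNorm R μ (fun x => f x - g x) ≤ ε) :
    IsIntegrable R μ f := by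
  choose g hg hgf using fun n : ℕ => h ((n : ℝ≥0∞)⁻¹) (by simp)
  exact ⟨g, hg, tendsto_of_tendsto_of_tendsto_of_le_of_le tendsto_const_nhds
    ENNReal.tendsto_inv_nat_nhds_zero (fun _ => zero_le) hgf⟩

end RegularMeasure

/-! ### Transfer of quantifiers and countable saturation -/

section Ultraproduct

variable {I : Type*}

/-- The element of an ultraproduct with components `x i`. -/
abbrev Star.mk (U : Ultrafilter I) {Y : I → Type*} (x : ∀ i, Y i) : Star U Y :=
  Quotient.mk (productSetoid (U : Filter I) Y) x

theorem Star.exists_mk {U : Ultrafilter I} {Y : I → Type*} (x : Star U Y) :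
    ∃ y : ∀ i, Y i, Star.mk U y = x :=
  Quotient.exists_rep x

theorem mk_mem_elems {U : Ultrafilter I} {X : I → Type*} {x : ∀ i, X i} {A : ∀ i, Set (X i)} :
    Star.mk U x ∈ elems (Star.mk U A) ↔ ∀ᶠ i in U, x i ∈ A i :=
  Iff.rfl

/-- Test the hypothesis on a family that picks a counterexample at each index that has one. -/
theorem eventually_forall_of_forall_eventually {l : Filter I} {Y : I → Type*} [∀ i, Nonempty (Y i)]
    {p : ∀ i, Y i → Prop} (h : ∀ y : ∀ i, Y i, ∀ᶠ i in l, p i (y i)) :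
    ∀ᶠ i in l, ∀ y, p i y := by
  have : ∀ i, ∃ y, p i y → ∀ z, p i z := fun i => by
    by_cases hi : ∀ z, p i z
    · exact ⟨Classical.arbitrary _, fun _ => hi⟩
    · obtain ⟨z, hz⟩ := not_forall.1 hi
      exact ⟨z, fun h => (hz h).elim⟩
  choose y hy using this
  exact (h y).mono fun i hi => hy i hi

theorem exists_eventually_of_eventually_exists {l : Filter I} {Y : I → Type*}
    [∀ i, Nonempty (Y i)] {p : ∀ i, Y i → Prop} (h : ∀ᶠ i in l, ∃ y, p i y) :
    ∃ y : ∀ i, Y i, ∀ᶠ i in l, p i (y i) := by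
  have : ∀ i, ∃ y, (∃ z, p i z) → p i y := fun i => by
    by_cases hi : ∃ z, p i z
    · exact ⟨hi.choose, fun _ => hi.choose_spec⟩
    · exact ⟨Classical.arbitrary _, fun h => (hi h).elim⟩
  choose y hy using this
  exact ⟨y, h.mono hy⟩

/-- Countable saturation of ultraproducts by countably incomplete ultrafilters. -/
theorem exists_forall_eventually {U : Ultrafilter I} (hU : ¬ CountableInterFilter (U : Filter I))
    {Y : I → Type*} [∀ i, Nonempty (Y i)] (p : ℕ → ∀ i, Y i → Prop)
    (h : ∀ n, ∀ᶠ i in U, ∃ y, ∀ m ≤ n, p m i y) :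
    ∃ y : ∀ i, Y i, ∀ n, ∀ᶠ i in U, p n i (y i) := by
  classical
  obtain ⟨S, hS, hSU⟩ : ∃ S : ℕ → Set I, (∀ n, S n ∈ U) ∧ ⋂ n, S n ∉ U := by
    by_contra! hc
    refine hU ⟨fun T hT hTU => ?_⟩
    rcases T.eq_empty_or_nonempty with rfl | hne
    · simp
    · obtain ⟨S, rfl⟩ := hT.exists_eq_range hne
      rw [Set.sInter_range]
      exact hc S fun n => hTU _ ⟨n, rfl⟩
  let q : I → ℕ → Prop := fun i n => ∃ y, ∀ m ≤ n, p m i y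
  -- `Nat.find hi` is the first stage at which i leaves the sets S m; it exceeds any given n for
  -- almost all i. N i is the largest stage up to there whose conditions are jointly satisfiable at
  -- i.
  let N : I → ℕ := fun i =>
    if hi : ∃ m, i ∉ S m then Nat.findGreatest (q i) (Nat.find hi) else 0
  have hN : ∀ i, ∃ y, q i (N i) → ∀ m ≤ N i, p m i y := fun i => by
    by_cases hq : q i (N i)
    · exact ⟨hq.choose, fun _ => hq.choose_spec⟩
    · exact ⟨Classical.arbitrary _, fun h => (hq h).elim⟩
  choose y hy using hN
  refine ⟨y, fun n => ?_⟩
  have h1 : ∀ᶠ i in U, i ∉ ⋂ n, S n := Ultrafilter.compl_mem_iff_notMem.2 hSU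
  have h2 : ∀ᶠ i in U, ∀ m ∈ Set.Iic n, i ∈ S m :=
    (Set.finite_Iic n).eventually_all.2 fun m _ => hS m
  filter_upwards [h1, h2, h n] with i hi1 hi2 hi3
  have hi : ∃ m, i ∉ S m := by simpa using hi1
  have hle : n ≤ Nat.find hi := by
    by_contra! hlt
    exact Nat.find_spec hi (hi2 _ hlt.le)
  have hNi : N i = Nat.findGreatest (q i) (Nat.find hi) := dif_pos hi
  refine hy i ?_ n ?_
  · rw [hNi]; exact Nat.findGreatest_spec hle hi3
  · rw [hNi]; exact Nat.le_findGreatest hle hi3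

end Ultraproduct

/-! ### Standard parts of measures, set norms and weights -/

section LoebSpace

variable {I : Type*} {U : Ultrafilter I} {X : I → Type*} {K : Type*} [NontriviallyNormedField K]

/-- The hypotheses on the internal measure space in terms of components: almost all of them are
regular, and the internal measure has nearstandard values. -/
structure IsLoebSpace (U : Ultrafilter I) (M : ∀ i, FinAddMeasureSpace (X i) K) : Prop where
  regular : ∀ᶠ i in U, IsRegular (M i).sets (M i).μ
  nearstandard : ∀ A : ∀ i, Set (X i), (∀ᶠ i in U, A i ∈ (M i).sets) →
    ∃ a, Tendsto (fun i => (M i).μ (A i)) U (𝓝 a)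

variable (M : ∀ i, FinAddMeasureSpace (X i) K)

theorem eventually_isRegular [∀ i, Nonempty (X i)]
    (hweight : ∀ A ∈ measSets (U := U) M, IsLUB (intWeight M '' elems A) (intSetNorm M A)) :
    ∀ᶠ i in U, IsRegular (M i).sets (M i).μ := by
  have h : ∀ᶠ i in U, ∀ A, A ∈ (M i).sets →
      setNorm (M i).sets (M i).μ A ≤ ⨆ x ∈ A, weight (M i).sets (M i).μ x := by
    refine eventually_forall_of_forall_eventually fun A => ?_
    refine Ultrafilter.eventually_imp.2 fun hA => ?_
    -- The componentwise suprema form an internal upper bound of the weights on A, so they dominate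
    -- the least upper bound.
    have h1 : intSetNorm M (Star.mk U A) ≤ ((fun i => ⨆ x ∈ A i,
        weight (M i).sets (M i).μ x : I → ℝ≥0∞) : Germ (U : Filter I) ℝ≥0∞) := by
      refine (hweight (Star.mk U A) hA).2 ?_
      rintro _ ⟨x, hx, rfl⟩
      obtain ⟨x, rfl⟩ := Star.exists_mk x
      have hx : ∀ᶠ i in U, x i ∈ A i := hx
      exact Germ.coe_le.2 (hx.mono fun i hi => le_iSup₂_of_le (x i) hi le_rfl)
    exact Germ.coe_le.1 h1
  exact h.mono fun i hi => ⟨(M i).isSetRing, (M i).additive, hi⟩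

/-- The (external) set `A` agrees with the internal set with components `B i ∈ 𝒮 i` outside a Loeb
null set. -/
structure Represents (U : Ultrafilter I) (M : ∀ i, FinAddMeasureSpace (X i) K)
    (B : ∀ i, Set (X i)) (A : Set (Star U X)) : Prop where
  mem_sets : ∀ᶠ i in U, B i ∈ (M i).sets
  mem_iff : ∀ x : ∀ i, X i, ¬ Tendsto (fun i => weight (M i).sets (M i).μ (x i)) U (𝓝 0) →
    (Star.mk U x ∈ A ↔ ∀ᶠ i in U, x i ∈ B i)

variable {M}

theorem represents_iff {A : Set (Star U X)} {B : ∀ i, Set (X i)} :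
    Represents U M B A ↔ Star.mk U B ∈ measSets (U := U) M ∧
      IsLoebNull M (symmDiff A (elems (Star.mk U B))) := by
  refine ⟨fun h => ⟨h.1, fun x hx => ?_⟩, fun h => ⟨h.1, fun x hx => ?_⟩⟩
  · obtain ⟨x, rfl⟩ := Star.exists_mk x
    by_contra hn
    have h1 := h.2 x hn
    rw [Set.mem_symmDiff, mk_mem_elems] at hx
    tauto
  · have h1 : ¬ Star.mk U x ∈ symmDiff A (elems (Star.mk U B)) := fun h' => hx (h.2 _ h')
    rw [Set.mem_symmDiff, mk_mem_elems] at h1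
    tauto

theorem mem_loebSets_iff {A : Set (Star U X)} :
    A ∈ loebSets M ↔ ∃ B, Represents U M B A := by
  constructor
  · rintro ⟨B, hB⟩
    obtain ⟨B, rfl⟩ := Star.exists_mk B
    exact ⟨B, represents_iff.2 hB⟩
  · rintro ⟨B, hB⟩
    exact ⟨_, represents_iff.1 hB⟩

theorem represents_elems {B : ∀ i, Set (X i)} (hB : ∀ᶠ i in U, B i ∈ (M i).sets) :
    Represents U M B (elems (Star.mk U B)) :=
  ⟨hB, fun _ _ => mk_mem_elems⟩

theorem represents_empty : Represents U M (fun _ => ∅) ∅ :=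
  ⟨Eventually.of_forall fun i => (M i).isSetRing.empty_mem,
    fun _ _ => by simp [U.neBot.ne]⟩

variable {A A' : Set (Star U X)} {B B' : ∀ i, Set (X i)}

theorem Represents.union (h : Represents U M B A) (h' : Represents U M B' A') :
    Represents U M (fun i => B i ∪ B' i) (A ∪ A') := by
  refine ⟨?_, fun x hx => ?_⟩
  · filter_upwards [h.1, h'.1] with i hi hi' using (M i).isSetRing.union_mem hi hi'
  · simp only [Set.mem_union, h.2 x hx, h'.2 x hx, Ultrafilter.eventually_or]

theorem Represents.inter (h : Represents U M B A) (h' : Represents U M B' A') :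
    Represents U M (fun i => B i ∩ B' i) (A ∩ A') := by
  refine ⟨?_, fun x hx => ?_⟩
  · filter_upwards [h.1, h'.1] with i hi hi' using (M i).isSetRing.inter_mem hi hi'
  · simp only [Set.mem_inter_iff, h.2 x hx, h'.2 x hx, eventually_and]

theorem Represents.sdiff (h : Represents U M B A) (h' : Represents U M B' A') :
    Represents U M (fun i => B i \ B' i) (A \ A') := by
  refine ⟨?_, fun x hx => ?_⟩
  · filter_upwards [h.1, h'.1] with i hi hi' using (M i).isSetRing.sdiff_mem hi hi'
  · simp only [Set.mem_sdiff, h.2 x hx, h'.2 x hx, eventually_and, Ultrafilter.eventually_not]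

theorem isSetRing_loebSets : MeasureTheory.IsSetRing (loebSets (U := U) M) where
  empty_mem := mem_loebSets_iff.2 ⟨_, represents_empty⟩
  union_mem A A' hA hA' := by
    obtain ⟨B, hB⟩ := mem_loebSets_iff.1 hA
    obtain ⟨B', hB'⟩ := mem_loebSets_iff.1 hA'
    exact mem_loebSets_iff.2 ⟨_, hB.union hB'⟩
  sdiff_mem A A' hA hA' := by
    obtain ⟨B, hB⟩ := mem_loebSets_iff.1 hA
    obtain ⟨B', hB'⟩ := mem_loebSets_iff.1 hA'
    exact mem_loebSets_iff.2 ⟨_, hB.sdiff hB'⟩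

section

variable [∀ i, Nonempty (X i)]

/-- This is where the supremum formula enters: pointwise infinitesimal weights on an internal set
have an infinitesimal supremum. -/
theorem tendsto_setNorm_zero (hM : IsLoebSpace U M) (hB : ∀ᶠ i in U, B i ∈ (M i).sets)
    (h : ∀ x : ∀ i, X i, (∀ᶠ i in U, x i ∈ B i) →
      Tendsto (fun i => weight (M i).sets (M i).μ (x i)) U (𝓝 0)) :
    Tendsto (fun i => setNorm (M i).sets (M i).μ (B i)) U (𝓝 0) := by
  refine ENNReal.tendsto_nhds_zero.2 fun ε hε => ?_
  have h1 : ∀ᶠ i in U, ∀ x, x ∈ B i → weight (M i).sets (M i).μ x ≤ ε :=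
    eventually_forall_of_forall_eventually fun x => Ultrafilter.eventually_imp.2 fun hx =>
      ENNReal.tendsto_nhds_zero.1 (h x hx) ε hε
  filter_upwards [h1, hB, hM.regular] with i hi hBi hr
  exact (hr.setNorm_le _ hBi).trans (iSup₂_le hi)

/-- The value does not depend on the representative: two of them differ by internal sets consisting
of null points, and these have infinitesimal norm. -/
theorem Represents.tendsto_loebMeasure [IsUltrametricDist K] (hM : IsLoebSpace U M)
    (h : Represents U M B A) :
    Tendsto (fun i => (M i).μ (B i)) U (𝓝 (loebMeasure M A)) := by
  have hex : ∃ B ∈ measSets (U := U) M, IsLoebNull M (symmDiff A (elems B)) :=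
    ⟨_, represents_iff.1 h⟩
  obtain ⟨B', hB'⟩ := Star.exists_mk hex.choose
  have h' : Represents U M B' A := represents_iff.2 (hB' ▸ hex.choose_spec)
  have hns : IsNearstandard (intMeasure M (Star.mk U B')) := hM.nearstandard B' h'.1
  have hlim : Tendsto (fun i => (M i).μ (B' i)) U (𝓝 (loebMeasure M A)) := by
    rw [loebMeasure, dif_pos hex, ← hB', st, dif_pos hns]
    exact hns.choose_spec
  have hnull : ∀ {B B' : ∀ i, Set (X i)}, Represents U M B A → Represents U M B' A →
      Tendsto (fun i => setNorm (M i).sets (M i).μ (B i \ B' i)) U (𝓝 0) := by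
    intro B B' h h'
    refine tendsto_setNorm_zero hM (h.sdiff h').1 fun x hx => ?_
    by_contra hn
    have := ((h.sdiff h').2 x hn).2 hx
    simp at this
  have h0 : Tendsto (fun i => (M i).μ (B i) - (M i).μ (B' i)) U (𝓝 0) := by
    have hmax := (hnull h h').max (hnull h' h)
    rw [max_self] at hmax
    rw [tendsto_iff_enorm_sub_tendsto_zero]
    refine tendsto_of_tendsto_of_tendsto_of_le_of_le' tendsto_const_nhds hmax
      (Eventually.of_forall fun _ => zero_le) ?_
    filter_upwards [h.1, h'.1, hM.regular] with i hi hi' hr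
    have h1 := hr.measure_split hi hi'
    have h2 := hr.measure_split hi' hi
    rw [Set.inter_comm] at h2
    have h3 : (M i).μ (B i) - (M i).μ (B' i) =
        (M i).μ (B i \ B' i) + -(M i).μ (B' i \ B i) := by
      rw [h1, h2]; ring
    rw [sub_zero, h3]
    refine (enorm_add_le_max _ _).trans ?_
    rw [enorm_neg]
    exact max_le_max (enorm_le_setNorm ((M i).isSetRing.sdiff_mem hi hi') subset_rfl)
      (enorm_le_setNorm ((M i).isSetRing.sdiff_mem hi' hi) subset_rfl)
  simpa using hlim.add h0

/-- Loeb subsets of A have internal representatives inside B, which bounds the limit from below.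
Conversely, internal subsets of B of nearly maximal measure can be cut down to Loeb subsets of A
without changing the limit of their measures. -/
theorem Represents.tendsto_setNorm [IsUltrametricDist K] (hM : IsLoebSpace U M)
    (h : Represents U M B A) :
    Tendsto (fun i => setNorm (M i).sets (M i).μ (B i)) U
      (𝓝 (setNorm (loebSets M) (loebMeasure M) A)) := by
  refine tendsto_order.2 ⟨fun c hc => ?_, fun c hc => ?_⟩
  · obtain ⟨C, hC, hCA, hc⟩ := lt_setNorm hc
    obtain ⟨D, hD⟩ := mem_loebSets_iff.1 hC
    have hDB := hD.inter h
    rw [Set.inter_eq_left.2 hCA] at hDB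
    filter_upwards [(hDB.tendsto_loebMeasure hM).enorm.eventually_const_lt hc, hDB.1] with i hi hs
    exact hi.trans_le (enorm_le_setNorm hs Set.inter_subset_right)
  · obtain ⟨c', hc', hcc⟩ := exists_between hc
    by_contra hn
    rw [← Ultrafilter.eventually_not] at hn
    have h1 : ∀ᶠ i in U, ∃ D, D ∈ (M i).sets ∧ D ⊆ B i ∧ c' < ‖(M i).μ D‖ₑ :=
      hn.mono fun i hi => lt_setNorm (hcc.trans_le (not_lt.1 hi))
    obtain ⟨D, hD⟩ := exists_eventually_of_eventually_exists h1
    have hDr : Represents U M (fun i => D i ∩ B i) (elems (Star.mk U D) ∩ A) :=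
      (represents_elems (hD.mono fun i hi => hi.1)).inter h
    have h2 := (hDr.tendsto_loebMeasure hM).enorm
    have h3 : c' ≤ ‖loebMeasure M (elems (Star.mk U D) ∩ A)‖ₑ :=
      ge_of_tendsto h2 (hD.mono fun i hi => by
        rw [Set.inter_eq_left.2 hi.2.1]; exact hi.2.2.le)
    exact hc'.not_ge (h3.trans (enorm_le_setNorm (mem_loebSets_iff.2 ⟨_, hDr⟩)
      Set.inter_subset_right))

/-- Nearstandard values force finiteness: if ‖B‖_ν were infinite, some internal D ⊆ B would have
|ν(D)| > ‖B‖_ν / 2, which is also infinite. -/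
theorem Represents.setNorm_lt_top [IsUltrametricDist K] (hM : IsLoebSpace U M)
    (h : Represents U M B A) :
    setNorm (loebSets M) (loebMeasure M) A < ∞ := by
  by_contra hn
  have h1 := h.tendsto_setNorm hM
  rw [not_lt_top_iff.1 hn] at h1
  have h2 : ∀ᶠ i in U, ∃ D, D ∈ (M i).sets ∧ D ⊆ B i ∧
      setNorm (M i).sets (M i).μ (B i) / 2 < ‖(M i).μ D‖ₑ := by
    filter_upwards [h.1, h1.eventually_const_lt ENNReal.zero_lt_top] with i hi hi'
    exact lt_setNorm (ENNReal.half_lt_self hi'.ne' ((M i).bounded _ hi).ne)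
  obtain ⟨D, hD⟩ := exists_eventually_of_eventually_exists h2
  obtain ⟨a, ha⟩ := hM.nearstandard D (hD.mono fun i hi => hi.1)
  have h3 := ENNReal.Tendsto.div_const h1 (b := 2) (Or.inr (by simp))
  have h4 := le_of_tendsto_of_tendsto h3 ha.enorm (hD.mono fun i hi => hi.2.2.le)
  rw [ENNReal.top_div_of_ne_top (by simp), top_le_iff] at h4
  exact enorm_ne_top h4

theorem tendsto_weight [IsUltrametricDist K] (hM : IsLoebSpace U M) (x : ∀ i, X i) :
    Tendsto (fun i => weight (M i).sets (M i).μ (x i)) U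
      (𝓝 (weight (loebSets M) (loebMeasure M) (Star.mk U x))) := by
  refine tendsto_order.2 ⟨fun c hc => ?_, fun c hc => ?_⟩
  · obtain ⟨c', hc', hcc⟩ := exists_between hc
    by_contra hn
    rw [← Ultrafilter.eventually_not] at hn
    have h1 : ∀ᶠ i in U, ∃ D, D ∈ (M i).sets ∧ x i ∈ D ∧ setNorm (M i).sets (M i).μ D < c' :=
      hn.mono fun i hi => weight_lt ((not_lt.1 hi).trans_lt hc')
    obtain ⟨D, hD⟩ := exists_eventually_of_eventually_exists h1
    have hDr := represents_elems (hD.mono fun i hi => hi.1)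
    have h2 := le_of_tendsto (hDr.tendsto_setNorm hM) (hD.mono fun i hi => hi.2.2.le)
    exact hcc.not_ge ((weight_le_setNorm (mem_loebSets_iff.2 ⟨_, hDr⟩)
      (mk_mem_elems.2 (hD.mono fun i hi => hi.2.1))).trans h2)
  · obtain ⟨A, hA, hx, hc⟩ := weight_lt hc
    obtain ⟨B, hB⟩ := mem_loebSets_iff.1 hA
    -- At a null point, membership in A says nothing about membership in B, but there the weight is
    -- infinitesimal anyway.
    by_cases h0 : Tendsto (fun i => weight (M i).sets (M i).μ (x i)) U (𝓝 0)
    · exact h0.eventually_lt_const (pos_of_gt hc)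
    · filter_upwards [(hB.tendsto_setNorm hM).eventually_lt_const hc, (hB.2 x h0).1 hx, hB.1]
        with i hi hxi hs
      exact (weight_le_setNorm hs hxi).trans_lt hi

theorem tendsto_weight_zero_iff [IsUltrametricDist K] (hM : IsLoebSpace U M) (x : ∀ i, X i) :
    Tendsto (fun i => weight (M i).sets (M i).μ (x i)) U (𝓝 0) ↔
      weight (loebSets M) (loebMeasure M) (Star.mk U x) = 0 :=
  ⟨fun h => tendsto_nhds_unique (tendsto_weight hM x) h, fun h => h ▸ tendsto_weight hM x⟩

theorem Represents.mem_iff_of_weight_ne_zero [IsUltrametricDist K] (hM : IsLoebSpace U M)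
    (h : Represents U M B A)
    {x : ∀ i, X i} (hx : weight (loebSets M) (loebMeasure M) (Star.mk U x) ≠ 0) :
    Star.mk U x ∈ A ↔ ∀ᶠ i in U, x i ∈ B i :=
  h.2 x fun h' => hx ((tendsto_weight_zero_iff hM x).1 h')

theorem weight_lt_top [IsUltrametricDist K] (hM : IsLoebSpace U M) (x : Star U X) :
    weight (loebSets M) (loebMeasure M) x < ∞ := by
  obtain ⟨x, rfl⟩ := Star.exists_mk x
  choose D hD hx using fun i => (M i).covering (x i)
  have hDr := represents_elems (U := U) (Eventually.of_forall hD)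
  exact (weight_le_setNorm (mem_loebSets_iff.2 ⟨_, hDr⟩)
    (mk_mem_elems.2 (Eventually.of_forall hx))).trans_lt (hDr.setNorm_lt_top hM)

theorem isRegular_loeb [IsUltrametricDist K] (hM : IsLoebSpace U M) :
    IsRegular (loebSets (U := U) M) (loebMeasure M) where
  isSetRing := isSetRing_loebSets
  additive A hA A' hA' hd := by
    obtain ⟨B, hB⟩ := mem_loebSets_iff.1 hA
    obtain ⟨B', hB'⟩ := mem_loebSets_iff.1 hA'
    -- Disjoint Loeb sets may have overlapping representatives; B' \ B still represents A' and is
    -- disjoint from B.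
    have h1 := hB'.sdiff hB
    rw [hd.symm.sdiff_eq_left] at h1
    refine tendsto_nhds_unique ((hB.union h1).tendsto_loebMeasure hM)
      (((hB.tendsto_loebMeasure hM).add (h1.tendsto_loebMeasure hM)).congr' ?_)
    filter_upwards [hB.1, h1.1] with i hi hi'
    exact ((M i).additive _ hi _ hi' Set.disjoint_sdiff_right).symm
  setNorm_le A hA := by
    obtain ⟨B, hB⟩ := mem_loebSets_iff.1 hA
    refine le_of_forall_lt_imp_le_of_dense fun c hc => ?_
    rcases eq_zero_or_pos c with rfl | h0
    · exact zero_le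
    -- A point of B with weight above c > 0 is not null, hence it belongs to A as well.
    have h1 : ∀ᶠ i in U, ∃ x, x ∈ B i ∧ c < weight (M i).sets (M i).μ x := by
      filter_upwards [(hB.tendsto_setNorm hM).eventually_const_lt hc, hB.1, hM.regular]
        with i hi hs hr
      simpa only [lt_iSup_iff, exists_prop] using hi.trans_le (hr.setNorm_le _ hs)
    obtain ⟨x, hx⟩ := exists_eventually_of_eventually_exists h1
    have h2 := ge_of_tendsto (tendsto_weight hM x) (hx.mono fun i hi => hi.2.le)
    refine le_iSup₂_of_le (Star.mk U x) ?_ h2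
    exact (hB.mem_iff_of_weight_ne_zero hM (h0.trans_le h2).ne').2 (hx.mono fun i hi => hi.1)

end

end LoebSpace

theorem isSimple_sum {X K ι : Type*} [NontriviallyNormedField K] [Fintype ι] {R : Set (Set X)}
    {A : ι → Set X} (hA : ∀ j, A j ∈ R) (y : ι → K) :
    IsSimple R (fun x => ∑ j, (A j).indicator (fun _ => y j) x) := by
  refine ⟨Fintype.card ι, fun j => A ((Fintype.equivFin ι).symm j),
    fun j => y ((Fintype.equivFin ι).symm j), fun j => hA _, fun x => ?_⟩
  exact ((Fintype.equivFin ι).symm.sum_comp fun j => (A j).indicator (fun _ => y j) x).symm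

/-! ### Liftings, comparison of norms, and parts (a) and (c) -/

section Approximation

variable {I : Type*} {U : Ultrafilter I} {X : I → Type*}
  {K : Type*} [NontriviallyNormedField K] {M : ∀ i, FinAddMeasureSpace (X i) K}

/-- `|G| N_ν` is infinitesimal at the points with infinitesimal weight. -/
def VanishesOnNull (U : Ultrafilter I) (M : ∀ i, FinAddMeasureSpace (X i) K)
    (G : ∀ i, X i → K) : Prop :=
  ∀ x : ∀ i, X i, weight (loebSets M) (loebMeasure M) (Star.mk U x) = 0 →
    Tendsto (fun i => ‖G i (x i)‖ₑ * weight (M i).sets (M i).μ (x i)) U (𝓝 0)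

/-- `‖G χ_B‖_ν` is infinitesimal if `‖B‖_ν` is. -/
def IsAbsCont (U : Ultrafilter I) (M : ∀ i, FinAddMeasureSpace (X i) K)
    (G : ∀ i, X i → K) : Prop :=
  ∀ B : ∀ i, Set (X i), (∀ᶠ i in U, B i ∈ (M i).sets) →
    Tendsto (fun i => setNorm (M i).sets (M i).μ (B i)) U (𝓝 0) →
    Tendsto (fun i => funNorm (M i).sets (M i).μ ((B i).indicator (G i))) U (𝓝 0)

/-- `G` tends to `f` pointwise outside a Loeb null set. -/
def TendsToOffNull (U : Ultrafilter I) (M : ∀ i, FinAddMeasureSpace (X i) K)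
    (G : ∀ i, X i → K) (f : Star U X → K) : Prop :=
  ∀ x : ∀ i, X i, weight (loebSets M) (loebMeasure M) (Star.mk U x) ≠ 0 →
    Tendsto (fun i => G i (x i)) U (𝓝 (f (Star.mk U x)))

/-- An internal function with finitely many standard values that agrees with the simple function
`f` outside a Loeb null set and has the same integral up to an infinitesimal. -/
structure IsSimpleLift (U : Ultrafilter I) (M : ∀ i, FinAddMeasureSpace (X i) K)
    (G : ∀ i, X i → K) (f : Star U X → K) : Prop where
  isSimple : ∀ᶠ i in U, IsSimple (M i).sets (G i)
  finite_values : ∃ T : Set K, T.Finite ∧ ∀ i x, G i x ∈ T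
  finite_norm : ∃ C : ℝ≥0, ∀ᶠ i in U, funNorm (M i).sets (M i).μ (G i) ≤ C
  eventually_eq : ∀ x : ∀ i, X i, weight (loebSets M) (loebMeasure M) (Star.mk U x) ≠ 0 →
    ∀ᶠ i in U, G i (x i) = f (Star.mk U x)
  tendsto_integral : Tendsto (fun i => simpleIntegral (M i).sets (M i).μ (G i)) U
    (𝓝 (simpleIntegral (loebSets M) (loebMeasure M) f))

theorem VanishesOnNull.sub {F G : ∀ i, X i → K} (hF : VanishesOnNull U M F)
    (hG : VanishesOnNull U M G) : VanishesOnNull U M (fun i x => F i x - G i x) := by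
  intro x hx
  have h := (hF x hx).add (hG x hx)
  rw [add_zero] at h
  refine tendsto_of_tendsto_of_tendsto_of_le_of_le tendsto_const_nhds h (fun _ => zero_le)
    fun i => ?_
  dsimp only
  rw [← add_mul]
  gcongr
  exact enorm_sub_le

theorem TendsToOffNull.sub {F G : ∀ i, X i → K} {f g : Star U X → K}
    (hF : TendsToOffNull U M F f) (hG : TendsToOffNull U M G g) :
    TendsToOffNull U M (fun i x => F i x - G i x) (fun x => f x - g x) :=
  fun x hx => (hF x hx).sub (hG x hx)

theorem IsSimpleLift.tendsToOffNull {G : ∀ i, X i → K} {f : Star U X → K}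
    (h : IsSimpleLift U M G f) : TendsToOffNull U M G f := fun x hx =>
  tendsto_const_nhds.congr' ((h.eventually_eq x hx).mono fun _ hi => hi.symm)

theorem IsSimpleLift.isAbsCont {G : ∀ i, X i → K} {f : Star U X → K}
    (h : IsSimpleLift U M G f) : IsAbsCont U M G := by
  intro B hB hB0
  obtain ⟨T, hT, hGT⟩ := h.finite_values
  obtain ⟨C, hC⟩ := (hT.image (fun y : K => ‖y‖₊)).bddAbove
  have hlim : Tendsto (fun i => (C : ℝ≥0∞) * setNorm (M i).sets (M i).μ (B i)) U (𝓝 0) := by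
    simpa using ENNReal.Tendsto.const_mul (a := (C : ℝ≥0∞)) hB0 (Or.inr ENNReal.coe_ne_top)
  refine tendsto_of_tendsto_of_tendsto_of_le_of_le' tendsto_const_nhds hlim
    (Eventually.of_forall fun _ => zero_le) (hB.mono fun i hi => funNorm_le fun x => ?_)
  by_cases hx : x ∈ B i
  · rw [Set.indicator_of_mem hx, enorm_eq_nnnorm]
    gcongr
    · exact hC ⟨_, hGT i x, rfl⟩
    · exact weight_le_setNorm hi hx
  · simp [hx]

/-- Finitely many values leave a gap around 0. This gives condition (iii) for the lifting in part
(a). -/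
theorem IsSimpleLift.exists_gap {G : ∀ i, X i → K} {f : Star U X → K}
    (h : IsSimpleLift U M G f) : ∃ δ : ℝ, 0 < δ ∧ ∀ i x, G i x ≠ 0 → δ ≤ ‖G i x‖ := by
  obtain ⟨T, hT, hGT⟩ := h.finite_values
  have h1 : ∀ᶠ y in 𝓝[≠] (0 : K), y ∉ T := by
    have : (T \ {0})ᶜ ∈ 𝓝 (0 : K) :=
      (hT.subset Set.sdiff_subset).isClosed.isOpen_compl.mem_nhds (by simp)
    filter_upwards [mem_nhdsWithin_of_mem_nhds this, self_mem_nhdsWithin] with y hy hy0 hyT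
    exact hy ⟨hyT, hy0⟩
  rw [eventually_nhdsWithin_iff, Metric.eventually_nhds_iff] at h1
  obtain ⟨δ, hδ, h1⟩ := h1
  refine ⟨δ, hδ, fun i x hx => ?_⟩
  by_contra! hlt
  exact h1 (by simpa using hlt) hx (hGT i x)

variable [∀ i, Nonempty (X i)] [IsUltrametricDist K]

/-- By saturation a null point lies in an internal set of infinitesimal norm, where absolute
continuity applies. -/
theorem IsAbsCont.vanishesOnNull (hU : ¬ CountableInterFilter (U : Filter I))
    (hM : IsLoebSpace U M) {G : ∀ i, X i → K} (hG : IsAbsCont U M G) : VanishesOnNull U M G := by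
  intro x hx
  have hx0 := (tendsto_weight_zero_iff hM x).2 hx
  obtain ⟨B, hB⟩ := exists_forall_eventually hU
    (fun n i (B : Set (X i)) => B ∈ (M i).sets ∧ x i ∈ B ∧
      setNorm (M i).sets (M i).μ B < (n : ℝ≥0∞)⁻¹) (fun n => by
        filter_upwards [hx0.eventually_lt_const (u := (n : ℝ≥0∞)⁻¹) (by simp)] with i hi
        obtain ⟨B, hB, hxB, hlt⟩ := weight_lt hi
        refine ⟨B, fun m hm => ⟨hB, hxB, hlt.trans_le ?_⟩⟩
        gcongr)
  have hBn : Tendsto (fun i => setNorm (M i).sets (M i).μ (B i)) U (𝓝 0) := by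
    refine ENNReal.tendsto_nhds_zero.2 fun ε hε => ?_
    obtain ⟨n, hn⟩ := ENNReal.exists_inv_nat_lt hε.ne'
    exact (hB n).mono fun i hi => (hi.2.2.trans hn).le
  refine tendsto_of_tendsto_of_tendsto_of_le_of_le' tendsto_const_nhds
    (hG B ((hB 0).mono fun i hi => hi.1) hBn) (Eventually.of_forall fun _ => zero_le)
    ((hB 0).mono fun i hi => ?_)
  have := mul_weight_le_funNorm (M i).sets (M i).μ ((B i).indicator (G i)) (x i)
  rwa [Set.indicator_of_mem hi.2.1] at this

theorem tendsto_mul_weight (hM : IsLoebSpace U M) {G : ∀ i, X i → K} {g : Star U X → K}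
    (hg : TendsToOffNull U M G g) {x : ∀ i, X i}
    (hx : weight (loebSets M) (loebMeasure M) (Star.mk U x) ≠ 0) :
    Tendsto (fun i => ‖G i (x i)‖ₑ * weight (M i).sets (M i).μ (x i)) U
      (𝓝 (‖g (Star.mk U x)‖ₑ * weight (loebSets M) (loebMeasure M) (Star.mk U x))) :=
  ENNReal.Tendsto.mul (hg x hx).enorm (Or.inr (weight_lt_top hM _).ne) (tendsto_weight hM x)
    (Or.inr enorm_ne_top)

/-- At points of nonzero weight |G| N_ν converges to |g| N_{ν_L}. At null points the Loeb norm
carries no information, so `VanishesOnNull` must be assumed. -/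
theorem eventually_funNorm_le (hM : IsLoebSpace U M) {G : ∀ i, X i → K} {g : Star U X → K}
    (h0 : VanishesOnNull U M G) (hg : TendsToOffNull U M G g) {c : ℝ≥0∞}
    (hc : funNorm (loebSets M) (loebMeasure M) g < c) :
    ∀ᶠ i in U, funNorm (M i).sets (M i).μ (G i) ≤ c := by
  have h : ∀ᶠ i in U, ∀ x, ‖G i x‖ₑ * weight (M i).sets (M i).μ x ≤ c := by
    refine eventually_forall_of_forall_eventually fun x => ?_
    by_cases hx : weight (loebSets M) (loebMeasure M) (Star.mk U x) = 0
    · exact ((h0 x hx).eventually_lt_const (pos_of_gt hc)).mono fun _ hi => hi.le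
    · exact ((tendsto_mul_weight hM hg hx).eventually_lt_const
        ((mul_weight_le_funNorm _ _ _ _).trans_lt hc)).mono fun _ hi => hi.le
  exact h.mono fun i hi => funNorm_le hi

theorem funNorm_le_of_eventually (hM : IsLoebSpace U M) {G : ∀ i, X i → K} {g : Star U X → K}
    (hg : TendsToOffNull U M G g) {c : ℝ≥0∞}
    (hc : ∀ᶠ i in U, funNorm (M i).sets (M i).μ (G i) ≤ c) :
    funNorm (loebSets M) (loebMeasure M) g ≤ c := by
  refine funNorm_le fun x => ?_
  obtain ⟨x, rfl⟩ := Star.exists_mk x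
  by_cases hx : weight (loebSets M) (loebMeasure M) (Star.mk U x) = 0
  · simp [hx]
  · exact le_of_tendsto (tendsto_mul_weight hM hg hx)
      (hc.mono fun i hi => (mul_weight_le_funNorm _ _ _ _).trans hi)

theorem exists_isSimpleLift (hM : IsLoebSpace U M) {f : Star U X → K}
    (hf : IsSimple (loebSets M) f) : ∃ G, IsSimpleLift U M G f := by
  obtain ⟨n, A, y, hA⟩ := hf
  choose B hB using fun j => mem_loebSets_iff.1 (hA.1 j)
  let G : ∀ i, X i → K := fun i x => ∑ j, (B j i).indicator (fun _ => y j) x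
  have hBs : ∀ᶠ i in U, ∀ j, B j i ∈ (M i).sets := eventually_all.2 fun j => (hB j).1
  have hT : ∃ T : Set K, T.Finite ∧ ∀ i x, G i x ∈ T := by
    classical
    -- All values are subset sums of the coefficients, independently of i.
    refine ⟨Set.range fun s : Finset (Fin n) => ∑ j ∈ s, y j, Set.finite_range _, fun i x =>
      ⟨Finset.univ.filter fun j => x ∈ B j i, ?_⟩⟩
    simp only [G, Finset.sum_filter, Set.indicator_apply]
  refine ⟨G, hBs.mono fun i hi => ⟨n, fun j => B j i, y, hi, fun x => rfl⟩, hT, ?_, ?_, ?_⟩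
  · obtain ⟨T, hT, hGT⟩ := hT
    obtain ⟨C, hC⟩ := (hT.image (fun y : K => ‖y‖₊)).bddAbove
    have hev : ∀ᶠ i in U, ∀ j, setNorm (M i).sets (M i).μ (B j i) <
        setNorm (loebSets M) (loebMeasure M) (A j) + 1 :=
      eventually_all.2 fun j => ((hB j).tendsto_setNorm hM).eventually_lt_const
        (ENNReal.lt_add_right ((hB j).setNorm_lt_top hM).ne one_ne_zero)
    let D : ℝ≥0∞ := ∑ j, (setNorm (loebSets M) (loebMeasure M) (A j) + 1)
    have hD : D ≠ ∞ := ENNReal.sum_ne_top.2 fun j _ =>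
      ENNReal.add_ne_top.2 ⟨((hB j).setNorm_lt_top hM).ne, ENNReal.one_ne_top⟩
    refine ⟨C * D.toNNReal, ?_⟩
    filter_upwards [hev, hBs] with i hi hs
    refine funNorm_le fun x => ?_
    rw [ENNReal.coe_mul, ENNReal.coe_toNNReal hD]
    by_cases hx : ∃ j, x ∈ B j i
    · obtain ⟨j, hj⟩ := hx
      rw [enorm_eq_nnnorm]
      gcongr
      · exact hC ⟨_, hGT i x, rfl⟩
      · exact (weight_le_setNorm (hs j) hj).trans ((hi j).le.trans
          (Finset.single_le_sum (f := fun j => setNorm (loebSets M) (loebMeasure M) (A j) + 1)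
            (fun _ _ => zero_le) (Finset.mem_univ j)))
    · have : G i x = 0 := Finset.sum_eq_zero fun j _ =>
        Set.indicator_of_notMem (fun hj => hx ⟨j, hj⟩) _
      simp [this]
  · intro x hx
    have : ∀ᶠ i in U, ∀ j, x i ∈ B j i ↔ Star.mk U x ∈ A j := by
      refine eventually_all.2 fun j => ?_
      have h := (hB j).mem_iff_of_weight_ne_zero hM hx
      by_cases hj : Star.mk U x ∈ A j
      · exact (h.1 hj).mono fun i hi => by simp [hi, hj]
      · rw [h, ← Ultrafilter.eventually_not] at hj
        have hj' := hj
        rw [Ultrafilter.eventually_not, ← h] at hj'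
        exact hj.mono fun i hi => by simp [hi, hj']
    filter_upwards [this] with i hi
    rw [hA.2]
    refine Finset.sum_congr rfl fun j _ => ?_
    classical
    simp only [Set.indicator_apply, hi j]
  · rw [(isRegular_loeb hM).simpleIntegral_eq hA]
    refine (tendsto_finsetSum _ fun j _ =>
      ((hB j).tendsto_loebMeasure hM).const_mul (y j)).congr' ?_
    filter_upwards [hBs, hM.regular] with i hi hr
    exact (hr.simpleIntegral_eq ⟨hi, fun x => rfl⟩).symm

theorem IsLifting.tendsToOffNull (hM : IsLoebSpace U M) {F : ∀ i, X i → K} {f : Star U X → K}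
    (h : IsLifting M (Star.mk U F) f) : TendsToOffNull U M F f := by
  intro x hx
  by_contra hn
  exact hx ((tendsto_weight_zero_iff hM x).1 (h (Star.mk U x) hn))

/-- Every Loeb integrable function has an `S`-integrable lifting. -/
theorem exists_isSIntegrable_isLifting (hU : ¬ CountableInterFilter (U : Filter I))
    (hM : IsLoebSpace U M) {f : Star U X → K}
    (hf : IsIntegrable (loebSets M) (loebMeasure M) f) :
    ∃ F : Star U (fun i => X i → K), IsSIntegrable M F ∧ IsLifting M F f := by
  obtain ⟨a, ha, hlim⟩ := hf
  -- With n + 1 in place of n the bound at n = 0 is 1 rather than ∞; this is what makes ‖F‖_ν finite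
  -- below.
  have hex : ∀ n : ℕ, ∃ g, IsSimple (loebSets M) g ∧
      funNorm (loebSets M) (loebMeasure M) (fun x => f x - g x) < ((n : ℝ≥0∞) + 1)⁻¹ := fun n => by
    obtain ⟨m, hm⟩ := (hlim.eventually_lt_const (u := ((n : ℝ≥0∞) + 1)⁻¹) (by simp)).exists
    exact ⟨a m, ha m, hm⟩
  choose g hg hfg using hex
  choose G hG using fun n => exists_isSimpleLift hM (hg n)
  have hGG : ∀ n m, n ≤ m → ∀ᶠ i in U,
      funNorm (M i).sets (M i).μ (fun x => G m i x - G n i x) ≤ ((n : ℝ≥0∞) + 1)⁻¹ := by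
    intro n m hnm
    refine eventually_funNorm_le hM (((hG m).isAbsCont.vanishesOnNull hU hM).sub
      ((hG n).isAbsCont.vanishesOnNull hU hM))
      ((hG m).tendsToOffNull.sub (hG n).tendsToOffNull) ?_
    refine (funNorm_le_max _ _ (g := fun x => g m x - f x) (h := fun x => f x - g n x)
      (by simp)).trans_lt (max_lt ?_ (hfg n))
    rw [funNorm_sub_comm]
    refine (hfg m).trans_le ?_
    gcongr
  -- Saturation replaces a limit of the G_m: the first n conditions are satisfied by G_n itself.
  obtain ⟨F, hF⟩ := exists_forall_eventually hU
    (fun n i (F : X i → K) => IsSimple (M i).sets F ∧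
      funNorm (M i).sets (M i).μ (fun x => F x - G n i x) ≤ ((n : ℝ≥0∞) + 1)⁻¹) (fun n => by
        have h : ∀ᶠ i in U, ∀ m ∈ Set.Iic n,
            funNorm (M i).sets (M i).μ (fun x => G n i x - G m i x) ≤ ((m : ℝ≥0∞) + 1)⁻¹ :=
          (Set.finite_Iic n).eventually_all.2 fun m hm => hGG m n hm
        filter_upwards [h, (hG n).isSimple] with i hi hs
        exact ⟨G n i, fun m hm => ⟨hs, hi m hm⟩⟩)
  have hinv : ∀ ε : ℝ≥0∞, 0 < ε → ∃ n : ℕ, ((n : ℝ≥0∞) + 1)⁻¹ ≤ ε := fun ε hε => by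
    obtain ⟨n, hn⟩ := ENNReal.exists_inv_nat_lt hε.ne'
    exact ⟨n, (ENNReal.inv_le_inv.2 le_self_add).trans hn.le⟩
  have hind : ∀ n i (B : Set (X i)), funNorm (M i).sets (M i).μ (B.indicator (F i)) ≤
      max (funNorm (M i).sets (M i).μ (fun x => F i x - G n i x))
        (funNorm (M i).sets (M i).μ (B.indicator (G n i))) := fun n i B => by
    refine (funNorm_le_max _ _ (g := B.indicator fun x => F i x - G n i x)
      (h := B.indicator (G n i)) fun x => ?_).trans (max_le_max_right _ (funNorm_mono fun x => ?_))
    · by_cases hx : x ∈ B <;> simp [hx]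
    · by_cases hx : x ∈ B <;> simp [hx]
  refine ⟨Star.mk U F, ⟨(hF 0).mono fun i hi => hi.1, ?_, ?_, ?_⟩, ?_⟩
  · obtain ⟨C, hC⟩ := (hG 0).finite_norm
    refine ⟨max 1 C, Germ.coe_le.2 ?_⟩
    filter_upwards [hF 0, hC] with i hi hCi
    refine (funNorm_le_max _ _ (g := fun x => F i x - G 0 i x) (h := G 0 i) (by simp)).trans ?_
    rw [ENNReal.coe_max]
    exact max_le_max (hi.2.trans (by simp)) hCi
  · intro B hB hB0
    obtain ⟨B, rfl⟩ := Star.exists_mk B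
    refine ENNReal.tendsto_nhds_zero.2 fun ε hε => ?_
    obtain ⟨n, hn⟩ := hinv ε hε
    filter_upwards [ENNReal.tendsto_nhds_zero.1 ((hG n).isAbsCont B hB hB0) ε hε, hF n]
      with i hi hFi
    exact (hind n i (B i)).trans (max_le (hFi.2.trans hn) hi)
  · intro B hB hB0
    obtain ⟨B, rfl⟩ := Star.exists_mk B
    refine ENNReal.tendsto_nhds_zero.2 fun ε hε => ?_
    obtain ⟨n, hn⟩ := hinv ε hε
    obtain ⟨δ, hδ, hgap⟩ := (hG n).exists_gap
    -- Where F ≈ 0, either G_n = 0 or |G_n| ≥ δ > |F|; in the second case the ultrametric inequality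
    -- gives |G_n| ≤ |F - G_n|.
    have h : ∀ᶠ i in U, ∀ x, ‖(B i).indicator (G n i) x‖ₑ ≤ ‖F i x - G n i x‖ₑ := by
      refine eventually_forall_of_forall_eventually fun x => ?_
      by_cases hx : ∀ᶠ i in U, x i ∈ B i
      · have hFx : Tendsto (fun i => F i (x i)) U (𝓝 0) := hB0 (Star.mk U x) hx
        filter_upwards [(Metric.tendsto_nhds.1 hFx) δ hδ] with i hi
        rw [dist_zero_right] at hi
        by_cases hxi : x i ∈ B i
        · rw [Set.indicator_of_mem hxi]
          by_cases h0 : G n i (x i) = 0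
          · simp [h0]
          · have h1 := hi.trans_le (hgap i (x i) h0)
            have h2 := enorm_add_le_max (F i (x i)) (G n i (x i) - F i (x i))
            rw [add_sub_cancel, enorm_sub_rev] at h2
            exact (le_max_iff.1 h2).resolve_left fun h => h1.not_ge (enorm_le_iff_norm_le.1 h)
        · simp [hxi]
      · rw [← Ultrafilter.eventually_not] at hx
        exact hx.mono fun i hi => by simp [hi]
    filter_upwards [h, hF n] with i hi hFi
    exact (hind n i (B i)).trans (max_le (hFi.2.trans hn)
      ((funNorm_mono hi).trans (hFi.2.trans hn)))
  · intro x hx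
    obtain ⟨x, rfl⟩ := Star.exists_mk x
    refine (tendsto_weight_zero_iff hM x).2 ?_
    by_contra hw
    refine hx ?_
    have hwt := (weight_lt_top hM (Star.mk U x)).ne
    have hlt : weight (loebSets M) (loebMeasure M) (Star.mk U x) / 2 <
        weight (loebSets M) (loebMeasure M) (Star.mk U x) := ENNReal.half_lt_self hw hwt
    set w := weight (loebSets M) (loebMeasure M) (Star.mk U x) with hwdef
    -- The constant w / 2 lies below both the Loeb weight and almost all component weights, so both
    -- norm estimates bound the product. Dividing by it is possible because 0 < w < ∞.
    have h1 : Tendsto (fun i => ‖F i (x i) - f (Star.mk U x)‖ₑ * (w / 2)) U (𝓝 0) := by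
      refine ENNReal.tendsto_nhds_zero.2 fun ε hε => ?_
      obtain ⟨n, hn⟩ := hinv ε hε
      filter_upwards [(tendsto_weight hM x).eventually_const_lt hlt,
        (hG n).eventually_eq x hw, hF n] with i hwi hGi hFi
      have h2 : ‖F i (x i) - f (Star.mk U x)‖ₑ ≤
          max ‖F i (x i) - G n i (x i)‖ₑ ‖f (Star.mk U x) - g n (Star.mk U x)‖ₑ := by
        have := enorm_add_le_max (F i (x i) - G n i (x i)) (g n (Star.mk U x) - f (Star.mk U x))
        rw [enorm_sub_rev (g n _)] at this
        simpa [hGi] using this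
      refine (mul_le_mul_left h2 _).trans ?_
      rcases max_choice ‖F i (x i) - G n i (x i)‖ₑ ‖f (Star.mk U x) - g n (Star.mk U x)‖ₑ
        with h | h <;> rw [h]
      · exact (mul_le_mul_right hwi.le _).trans ((mul_weight_le_funNorm _ _
          (fun y => F i y - G n i y) (x i)).trans (hFi.2.trans hn))
      · exact (mul_le_mul_right hlt.le _).trans ((mul_weight_le_funNorm _ _
          (fun y => f y - g n y) (Star.mk U x)).trans ((hfg n).le.trans hn))
    have hw2 : w / 2 ≠ 0 := (ENNReal.half_pos hw).ne'
    have h3 := ENNReal.Tendsto.mul_const h1 (b := (w / 2)⁻¹) (Or.inr (ENNReal.inv_ne_top.2 hw2))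
    rw [zero_mul] at h3
    refine tendsto_iff_enorm_sub_tendsto_zero.2 (h3.congr fun i => ?_)
    rw [mul_assoc, ENNReal.mul_inv_cancel hw2 (hlt.trans_le le_top).ne, mul_one]

/-- Pass through a simple lift G of g: the basic estimate bounds the difference of the integrals of
F and G by ‖F - G‖_ν, which the norm comparison controls, and the integral of G is infinitely close
to that of g. -/
theorem eventually_enorm_simpleIntegral_sub_le (hU : ¬ CountableInterFilter (U : Filter I))
    (hM : IsLoebSpace U M) {f : Star U X → K} {F : ∀ i, X i → K}
    (hF : IsSIntegrable M (Star.mk U F)) (hFf : IsLifting M (Star.mk U F) f)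
    {g : Star U X → K} (hg : IsSimple (loebSets M) g) {c : ℝ≥0∞}
    (hc : funNorm (loebSets M) (loebMeasure M) (fun x => f x - g x) < c) :
    ∀ᶠ i in U, ‖simpleIntegral (M i).sets (M i).μ (F i) -
      simpleIntegral (loebSets M) (loebMeasure M) g‖ₑ ≤ c := by
  obtain ⟨G, hG⟩ := exists_isSimpleLift hM hg
  have hFa : IsAbsCont U M F := fun B => hF.absCont (Star.mk U B)
  have h1 := eventually_funNorm_le hM ((hFa.vanishesOnNull hU hM).sub
    (hG.isAbsCont.vanishesOnNull hU hM)) ((hFf.tendsToOffNull hM).sub hG.tendsToOffNull) hc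
  have hs : ∀ᶠ i in U, IsSimple (M i).sets (F i) := hF.starSimple
  filter_upwards [h1, hs, hG.isSimple, hM.regular, (tendsto_iff_enorm_sub_tendsto_zero.1
    hG.tendsto_integral).eventually_lt_const (pos_of_gt hc)] with i hi hFi hGi hr hlim
  rw [← sub_add_sub_cancel _ (simpleIntegral (M i).sets (M i).μ (G i))]
  exact (enorm_add_le_max _ _).trans
    (max_le ((hr.enorm_simpleIntegral_sub_le hFi hGi).trans hi) hlim.le)

/-- The integral of a Loeb integrable function is the standard part of the integral of every
`S`-integrable lifting. -/
theorem exists_hasIntegral_isSt [CompleteSpace K] (hU : ¬ CountableInterFilter (U : Filter I))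
    (hM : IsLoebSpace U M) {f : Star U X → K} {F : Star U (fun i => X i → K)}
    (hf : IsIntegrable (loebSets M) (loebMeasure M) f) (hF : IsSIntegrable M F)
    (hFf : IsLifting M F f) :
    ∃ a : K, HasIntegral (loebSets M) (loebMeasure M) f a ∧ IsSt (intIntegral M F) a := by
  obtain ⟨F, rfl⟩ := Star.exists_mk F
  have key := fun (g : Star U X → K) (hg : IsSimple (loebSets M) g) (c : ℝ≥0∞) =>
    eventually_enorm_simpleIntegral_sub_le hU hM hF hFf hg (c := c)
  -- The integrals of simple approximations g to f are standard centres of arbitrarily small balls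
  -- containing almost all component integrals of F.
  have hcauchy : Cauchy (map (fun i => simpleIntegral (M i).sets (M i).μ (F i))
      (U : Filter I)) := by
    refine EMetric.cauchy_iff.2 ⟨(U.neBot.map _).ne, fun ε hε => ?_⟩
    obtain ⟨g, hg, hlim⟩ := hf
    obtain ⟨c, hc0, hcε⟩ := exists_between hε
    obtain ⟨n, hn⟩ := (hlim.eventually_lt_const hc0).exists
    refine ⟨{y | ‖y - simpleIntegral (loebSets M) (loebMeasure M) (g n)‖ₑ ≤ c},
      key _ (hg n) c hn, fun y hy z hz => ?_⟩
    rw [edist_eq_enorm_sub,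
      ← sub_sub_sub_cancel_right y z (simpleIntegral (loebSets M) (loebMeasure M) (g n)),
      sub_eq_add_neg]
    refine (enorm_add_le_max _ _).trans_lt (max_lt (lt_of_le_of_lt hy hcε) ?_)
    rw [enorm_neg]
    exact lt_of_le_of_lt hz hcε
  obtain ⟨a, ha⟩ := cauchy_map_iff_exists_tendsto.1 hcauchy
  refine ⟨a, ⟨hf, fun g hg => ?_⟩, ha⟩
  refine tendsto_iff_enorm_sub_tendsto_zero.2 (ENNReal.tendsto_nhds_zero.2 fun ε hε => ?_)
  filter_upwards [hg.2.eventually_lt_const hε] with n hn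
  rw [enorm_sub_rev]
  exact le_of_tendsto (ha.sub_const _).enorm (key _ (hg.1 n) ε hn)

end Approximation

/-- On a bounded subset of a proper normed field the identity is uniformly approximated by
functions with finitely many values. -/
theorem exists_finite_range_enorm_sub_le {K : Type*} [NormedField K] [ProperSpace K]
    {T : Set K} (hT : Bornology.IsBounded T) {r : ℝ≥0} (hr : 0 < r) :
    ∃ φ : K → K, (Set.range φ).Finite ∧ (∀ y ∉ T, φ y = 0) ∧ ∀ y ∈ T, ‖y - φ y‖ₑ ≤ r := by
  classical
  obtain ⟨t, ht, hTt⟩ := Metric.totallyBounded_iff.1 (Metric.isCompact_of_isClosed_isBounded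
    isClosed_closure hT.closure |>.totallyBounded.subset subset_closure) r hr
  have h : ∀ y, ∃ z, (y ∈ T → z ∈ t ∧ ‖y - z‖ₑ ≤ r) := fun y => by
    by_cases hy : y ∈ T
    · obtain ⟨z, hz, hyz⟩ := Set.mem_iUnion₂.1 (hTt hy)
      refine ⟨z, fun _ => ⟨hz, ?_⟩⟩
      rw [Metric.mem_ball, dist_eq_norm] at hyz
      rw [enorm_eq_nnnorm]
      exact_mod_cast hyz.le
    · exact ⟨0, fun h => (hy h).elim⟩
  choose ψ hψ using h
  refine ⟨fun y => if y ∈ T then ψ y else 0, (ht.insert 0).subset ?_, fun y hy => if_neg hy,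
    fun y hy => ?_⟩
  · rintro _ ⟨y, rfl⟩
    by_cases hy : y ∈ T
    · simp [hy, (hψ y hy).1]
    · simp [hy]
  · simpa [hy] using (hψ y hy).2

/-! ### Cutoffs and rounding over a locally compact field: part (b) -/

section LocallyCompact

variable {I : Type*} {U : Ultrafilter I} {X : I → Type*}
  {K : Type*} [NontriviallyNormedField K] {M : ∀ i, FinAddMeasureSpace (X i) K}

/-- Otherwise saturation yields one B ∈ 𝒮 with |F| ≤ 1/n on B for all n and ‖F χ_B‖_ν > ε,
contradicting (iii). -/
theorem IsSIntegrable.exists_small_values (hU : ¬ CountableInterFilter (U : Filter I))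
    {F : ∀ i, X i → K} (hF : IsSIntegrable M (Star.mk U F)) {ε : ℝ≥0∞} (hε : 0 < ε) :
    ∃ n : ℕ, ∀ᶠ i in U, funNorm (M i).sets (M i).μ
      ({x | ‖F i x‖ₑ ≤ (n : ℝ≥0∞)⁻¹}.indicator (F i)) ≤ ε := by
  by_contra! hcon
  have hs : ∀ᶠ i in U, IsSimple (M i).sets (F i) := hF.starSimple
  obtain ⟨B, hB⟩ := exists_forall_eventually hU
    (fun n i (B : Set (X i)) => B ∈ (M i).sets ∧ (∀ y ∈ B, ‖F i y‖ₑ ≤ (n : ℝ≥0∞)⁻¹) ∧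
      ε < funNorm (M i).sets (M i).μ (B.indicator (F i))) (fun n => by
        filter_upwards [hcon n, hs] with i hi hFi
        -- Dropping the zeros of F keeps the set in the ring and does not change the truncated
        -- function.
        refine ⟨F i ⁻¹' {y | y ≠ 0 ∧ ‖y‖ₑ ≤ (n : ℝ≥0∞)⁻¹}, fun m hm =>
          ⟨hFi.preimage_mem (M i).isSetRing (by simp), fun y hy => hy.2.trans ?_,
            hi.trans_le (funNorm_mono fun x => ?_)⟩⟩
        · gcongr
        · by_cases h0 : F i x = 0
          · simp [h0]
          · by_cases hx : x ∈ {x | ‖F i x‖ₑ ≤ (n : ℝ≥0∞)⁻¹}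
            · rw [Set.indicator_of_mem (s := F i ⁻¹' {y | y ≠ 0 ∧ ‖y‖ₑ ≤ (n : ℝ≥0∞)⁻¹}) ⟨h0, hx⟩]
              exact enorm_indicator_le_enorm_self _ _
            · rw [Set.indicator_of_notMem hx]
              simp)
  have hlim : Tendsto (fun i => funNorm (M i).sets (M i).μ ((B i).indicator (F i))) U (𝓝 0) := by
    refine hF.small (Star.mk U B) ((hB 0).mono fun i hi => hi.1) fun x hx => ?_
    obtain ⟨x, rfl⟩ := Star.exists_mk x
    have hx : ∀ᶠ i in U, x i ∈ B i := hx
    have h0 : Tendsto (fun i => F i (x i)) U (𝓝 0) := by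
      refine tendsto_iff_enorm_sub_tendsto_zero.2 (ENNReal.tendsto_nhds_zero.2 fun η hη => ?_)
      obtain ⟨n, hn⟩ := ENNReal.exists_inv_nat_lt hη.ne'
      filter_upwards [hx, hB n] with i hxi hi
      rw [sub_zero]
      exact (hi.2.1 _ hxi).trans hn.le
    exact h0
  obtain ⟨i, hi, hi'⟩ := ((hlim.eventually_lt_const hε).and (hB 0)).exists
  exact hi.not_gt hi'.2.2

/-- Otherwise saturation yields one B ∈ 𝒮 with |F| > n on B for all n and ‖F χ_B‖_ν > ε. As |F| N_ν
is bounded by a finite C, the weights on B are infinitesimal, so ‖B‖_ν ≈ 0, contradicting (ii). -/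
theorem IsSIntegrable.exists_large_values [∀ i, Nonempty (X i)]
    (hU : ¬ CountableInterFilter (U : Filter I)) (hM : IsLoebSpace U M)
    {F : ∀ i, X i → K} (hF : IsSIntegrable M (Star.mk U F)) {ε : ℝ≥0∞} (hε : 0 < ε) :
    ∃ n : ℕ, ∀ᶠ i in U, funNorm (M i).sets (M i).μ
      ({x | (n : ℝ≥0∞) < ‖F i x‖ₑ}.indicator (F i)) ≤ ε := by
  by_contra! hcon
  have hs : ∀ᶠ i in U, IsSimple (M i).sets (F i) := hF.starSimple
  obtain ⟨B, hB⟩ := exists_forall_eventually hU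
    (fun n i (B : Set (X i)) => B ∈ (M i).sets ∧ (∀ y ∈ B, (n : ℝ≥0∞) < ‖F i y‖ₑ) ∧
      ε < funNorm (M i).sets (M i).μ (B.indicator (F i))) (fun n => by
        filter_upwards [hcon n, hs] with i hi hFi
        refine ⟨F i ⁻¹' {y | (n : ℝ≥0∞) < ‖y‖ₑ}, fun m hm =>
          ⟨hFi.preimage_mem (M i).isSetRing (by simp), fun y hy => lt_of_le_of_lt ?_ hy, hi⟩⟩
        exact_mod_cast hm)
  obtain ⟨C, hC⟩ := hF.finite
  have hC : ∀ᶠ i in U, funNorm (M i).sets (M i).μ (F i) ≤ C := Germ.coe_le.1 hC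
  have hBn : Tendsto (fun i => setNorm (M i).sets (M i).μ (B i)) U (𝓝 0) := by
    refine ENNReal.tendsto_nhds_zero.2 fun η hη => ?_
    obtain ⟨n, hn⟩ := ENNReal.exists_nat_mul_gt hη.ne' (ENNReal.coe_ne_top (r := C))
    filter_upwards [hB n, hC, hM.regular] with i hi hCi hr
    refine (hr.setNorm_le _ hi.1).trans (iSup₂_le fun x hx => ?_)
    by_contra! hlt
    refine hn.not_ge (le_trans ?_ ((mul_weight_le_funNorm _ _ (F i) x).trans hCi))
    exact mul_le_mul' (hi.2.1 x hx).le hlt.le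
  have hlim : Tendsto (fun i => funNorm (M i).sets (M i).μ ((B i).indicator (F i))) U (𝓝 0) :=
    hF.absCont (Star.mk U B) ((hB 0).mono fun i hi => hi.1) hBn
  obtain ⟨i, hi, hi'⟩ := ((hlim.eventually_lt_const hε).and (hB 0)).exists
  exact hi.not_gt hi'.2.2

/-- The composition of a finitely-valued function on `K` with an internal simple function has a
Loeb simple standard part. -/
theorem exists_isSimple_tendsToOffNull_comp {F : ∀ i, X i → K}
    (hF : ∀ᶠ i in U, IsSimple (M i).sets (F i)) {φ : K → K} (hφ : (Set.range φ).Finite)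
    (hφ0 : φ 0 = 0) :
    ∃ g, IsSimple (loebSets M) g ∧ TendsToOffNull U M (fun i x => φ (F i x)) g := by
  classical
  have := (hφ.subset (Set.sdiff_subset : Set.range φ \ {0} ⊆ _)).fintype
  let B : ↥(Set.range φ \ {0}) → ∀ i, Set (X i) := fun c i => F i ⁻¹' (φ ⁻¹' {(c : K)})
  have hB : ∀ c, elems (Star.mk U (B c)) ∈ loebSets (U := U) M := fun c =>
    mem_loebSets_iff.2 ⟨_, represents_elems (hF.mono fun i hi =>
      hi.preimage_mem (M i).isSetRing fun h => c.2.2 (by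
        have : φ 0 = (c : K) := h
        rw [Set.mem_singleton_iff, ← this, hφ0]))⟩
  refine ⟨_, isSimple_sum hB fun c => (c : K), fun x _ => ?_⟩
  -- An ultrafilter selects one of finitely many values.
  obtain ⟨c, -, hc⟩ : ∃ c ∈ Set.range φ, ∀ᶠ i in U, φ (F i (x i)) = c :=
    (Ultrafilter.eventually_exists_mem_iff hφ).1 (Eventually.of_forall fun i => ⟨_, ⟨_, rfl⟩, rfl⟩)
  have hmem : ∀ d : ↥(Set.range φ \ {0}), Star.mk U x ∈ elems (Star.mk U (B d)) ↔ c = d := by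
    intro d
    rw [mk_mem_elems]
    refine ⟨fun h => ?_, fun h => hc.mono fun i hi => hi.trans h⟩
    obtain ⟨i, hi, hi'⟩ := (hc.and h).exists
    exact hi.symm.trans hi'
  refine tendsto_const_nhds.congr' (hc.mono fun i hi => ?_)
  dsimp only
  rw [hi]
  simp only [Set.indicator_apply, hmem]
  by_cases h : c ∈ Set.range φ \ {0}
  · rw [Finset.sum_eq_single ⟨c, h⟩]
    · simp
    · intro d _ hd
      exact if_neg fun h' => hd (Subtype.ext h'.symm)
    · simp
  · rw [Finset.sum_eq_zero fun (d : ↥(Set.range φ \ {0})) _ =>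
      if_neg fun h' : c = d => h (h' ▸ d.2)]
    by_contra h'
    obtain ⟨i, hi⟩ := hc.exists
    exact h ⟨⟨_, hi⟩, fun h0 => h' h0.symm⟩

/-- Over a locally compact field the standard part of an `S`-integrable function is Loeb
integrable. -/
theorem isIntegrable_of_isLifting [∀ i, Nonempty (X i)] [IsUltrametricDist K] [ProperSpace K]
    (hU : ¬ CountableInterFilter (U : Filter I))
    (hM : IsLoebSpace U M) {F : Star U (fun i => X i → K)} (hF : IsSIntegrable M F)
    {f : Star U X → K} (hFf : IsLifting M F f) :
    IsIntegrable (loebSets M) (loebMeasure M) f := by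
  obtain ⟨F, rfl⟩ := Star.exists_mk F
  refine isIntegrable_of_forall fun ε hε => ?_
  obtain ⟨m, hm⟩ := hF.exists_small_values hU hε
  obtain ⟨n, hn⟩ := hF.exists_large_values hU hM hε
  obtain ⟨C, hC⟩ := hF.finite
  have hC : ∀ᶠ i in U, funNorm (M i).sets (M i).μ (F i) ≤ C := Germ.coe_le.1 hC
  -- Where |F| > 1/m, the weight is at most m |F| N_ν ≤ m C, so rounding F by at most r costs at
  -- most r m C < ε.
  obtain ⟨r, hr, hrε⟩ := ENNReal.exists_nnreal_pos_mul_lt (a := (m : ℝ≥0∞) * C)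
    (ENNReal.mul_ne_top (ENNReal.natCast_ne_top m) ENNReal.coe_ne_top) hε.ne'
  let T : Set K := {y | (m : ℝ≥0∞)⁻¹ < ‖y‖ₑ ∧ ‖y‖ₑ ≤ n}
  have hT : Bornology.IsBounded T := by
    refine Metric.isBounded_closedBall.subset (t := Metric.closedBall (0 : K) n) fun y hy => ?_
    have h : ‖y‖ₑ ≤ n := hy.2
    rw [enorm_eq_nnnorm] at h
    rw [mem_closedBall_zero_iff]
    exact_mod_cast h
  obtain ⟨φ, hφ, hφT, hφr⟩ := exists_finite_range_enorm_sub_le hT hr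
  obtain ⟨g, hg, hgφ⟩ := exists_isSimple_tendsToOffNull_comp (M := M) hF.starSimple hφ
    (hφT 0 fun h => by simpa [T] using h.1)
  refine ⟨g, hg, funNorm_le_of_eventually hM ((hFf.tendsToOffNull hM).sub hgφ) ?_⟩
  filter_upwards [hm, hn, hC] with i hmi hni hCi
  refine funNorm_le fun x => ?_
  by_cases hx : F i x ∈ T
  · refine le_trans ?_ hrε.le
    have h1 : 1 ≤ (m : ℝ≥0∞) * ‖F i x‖ₑ :=
      (ENNReal.inv_le_iff_le_mul (by simp) (by simp)).1 hx.1.le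
    calc _ ≤ (r : ℝ≥0∞) * weight (M i).sets (M i).μ x := by gcongr; exact hφr _ hx
      _ ≤ r * ((m * ‖F i x‖ₑ) * weight (M i).sets (M i).μ x) := by
          gcongr; exact le_mul_of_one_le_left' h1
      _ ≤ _ := by
          rw [mul_assoc]
          gcongr
          exact (mul_weight_le_funNorm _ _ (F i) x).trans hCi
  · rw [hφT _ hx, sub_zero]
    rcases not_and_or.1 hx with h | h
    · have := mul_weight_le_funNorm (M i).sets (M i).μ
        ({x | ‖F i x‖ₑ ≤ (m : ℝ≥0∞)⁻¹}.indicator (F i)) x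
      rw [Set.indicator_of_mem (show x ∈ {x | ‖F i x‖ₑ ≤ (m : ℝ≥0∞)⁻¹} from not_lt.1 h)] at this
      exact this.trans hmi
    · have := mul_weight_le_funNorm (M i).sets (M i).μ
        ({x | (n : ℝ≥0∞) < ‖F i x‖ₑ}.indicator (F i)) x
      rw [Set.indicator_of_mem (show x ∈ {x | (n : ℝ≥0∞) < ‖F i x‖ₑ} from not_le.1 h)] at this
      exact this.trans hni

end LocallyCompact

end NALoeb

theorem mainTheorem3
    {K : Type*} [NontriviallyNormedField K] [IsUltrametricDist K] [CompleteSpace K]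
    {I : Type*} (U : Ultrafilter I) (hU : ¬ CountableInterFilter (U : Filter I))
    {X : I → Type*} [∀ i, Nonempty (X i)]
    (M : ∀ i, NALoeb.FinAddMeasureSpace (X i) K)
    (hweight : ∀ A ∈ NALoeb.measSets (U := U) M,
      IsLUB (NALoeb.intWeight M '' NALoeb.elems A) (NALoeb.intSetNorm M A))
    (hns : ∀ A ∈ NALoeb.measSets (U := U) M, NALoeb.IsNearstandard (NALoeb.intMeasure M A)) :
    (∀ f : NALoeb.Star U X → K,
      NALoeb.IsIntegrable (NALoeb.loebSets M) (NALoeb.loebMeasure M) f →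
        ∃ F : NALoeb.Star U (fun i => X i → K),
          NALoeb.IsSIntegrable M F ∧ NALoeb.IsLifting M F f) ∧
    (LocallyCompactSpace K →
      ∀ F : NALoeb.Star U (fun i => X i → K), NALoeb.IsSIntegrable M F →
        ∀ f : NALoeb.Star U X → K, NALoeb.IsLifting M F f →
          NALoeb.IsIntegrable (NALoeb.loebSets M) (NALoeb.loebMeasure M) f) ∧
    (∀ (f : NALoeb.Star U X → K) (F : NALoeb.Star U (fun i => X i → K)),
      NALoeb.IsIntegrable (NALoeb.loebSets M) (NALoeb.loebMeasure M) f →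
      NALoeb.IsSIntegrable M F → NALoeb.IsLifting M F f →
        ∃ a : K, NALoeb.HasIntegral (NALoeb.loebSets M) (NALoeb.loebMeasure M) f a ∧
          NALoeb.IsSt (NALoeb.intIntegral M F) a) := by
  have hM : NALoeb.IsLoebSpace U M := ⟨NALoeb.eventually_isRegular M hweight,
    fun A hA => hns (NALoeb.Star.mk U A) hA⟩
  refine ⟨fun f hf => NALoeb.exists_isSIntegrable_isLifting hU hM hf, fun hK F hF f hFf => ?_,
    fun f F hf hF hFf => NALoeb.exists_hasIntegral_isSt hU hM hf hF hFf⟩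
  have : ProperSpace K := ProperSpace.of_locallyCompactSpace K
  exact NALoeb.isIntegrable_of_isLifting hU hM hF hFf
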